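/- Let $T$ be a once punctured torus, so that $\pi_1(T)$ is a free group of rank two, and let $\{a,b\}$ be a free basis of $\pi_1(T)$. Let $\Omega$ be the set of isotopy classes of unoriented essential (nontrivial, not boundary-parallel) simple closed curves in $T$. As usual, $\Omega$ is identified with the set of primitive elements of $\pi_1(T)$ (those belonging to some free basis) up to conjugation and inversion; thus $X\in\Omega$ is the union of the conjugacy classes of $g$ and $g^{-1}$ with $g$ primitive. Let $\Omega=\Omega_1\sqcup\Omega_2\sqcup\Omega_3$ be the partition of $\Omega$ by the three nonzero $\mathbf Z/2$-homology classes: $X$ lies in $\Omega_1$, $\Omega_2$ or $\Omega_3$ according as its class in $H_1(T;\mathbf Z/2)$ is $[a]$, $[b]$ or $[a]+[b]$. Let $\rho:\pi_1(T)\to \mathrm{SL}(2,\mathbf C)$ be an irreducible representation, let $\tau=\operatorname{tr}\rho(aba^{-1}b^{-1})$ and $\mu=\tau+2$. For $X\in\Omega$ represented by $g$, put $\operatorname{tr}\rho(X)=\operatorname{tr}\rho(g)$, which is well defined. Suppose that $\rho$ satisfies the Bowditch conditions: (i) $\operatorname{tr}\rho(X)\notin[-2,2]\subset\mathbf R$ for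 all $X\in\Omega$; (ii) the set $\{X\in\Omega : |\operatorname{tr}\rho(X)|\le 2\}$ is finite (possibly empty). For $p\in\mathbf C$ and $x\in\mathbf C\setminus([-2,2]\cup\{\pm\sqrt\mu\})$ let $$h_{\mu,p}(x)=\frac12\left(1-\frac{x^2-(1-p)\mu}{x^2-\mu}\sqrt{1-\frac4{x^2}}\right),$$ where the square root is the one with nonnegative real part. Then $\operatorname{tr}\rho(X)^2\neq\mu$ for all $X\in\Omega$, and for all $p_1,p_2,p_3\in\mathbf C$ with $p_1+p_2+p_3=1$, $$\sum_{X\in\Omega_1}h_{\mu,p_1}(\operatorname{tr}\rho(X))+\sum_{X\in\Omega_2}h_{\mu,p_2}(\operatorname{tr}\rho(X))+\sum_{X\in\Omega_3}h_{\mu,p_3}(\operatorname{tr}\rho(X))=\frac12,$$ where each of the three sums converges absolutely. -/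

import Mathlib

namespace PuncturedTorus

/-- An element of `Γ` that belongs to a free basis `{a, b}` of `Γ` (`Γ` free of rank two). -/
def IsPrimitive {Γ : Type*} [Group Γ] (g : Γ) : Prop :=
  ∃ c : FreeGroupBasis (Fin 2) Γ, c 0 = g

/-- Two primitive elements represent the same unoriented free homotopy class of curves
when they are conjugate up to inversion. -/
def curveSetoid (Γ : Type*) [Group Γ] : Setoid {g : Γ // IsPrimitive g} where
  r g h := IsConj g.1 h.1 ∨ IsConj g.1 h.1⁻¹
  iseqv :=
    { refl := fun g => Or.inl (IsConj.refl g.1)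
      symm := by
        have key : ∀ x y : Γ, IsConj x y⁻¹ → IsConj y x⁻¹ := by
          intro x y h
          obtain ⟨c, hc⟩ := isConj_iff.1 h
          refine IsConj.symm (isConj_iff.2 ⟨c, ?_⟩)
          have h2 := congrArg (fun z => z⁻¹) hc
          simpa [mul_assoc] using h2
        intro g h hgh
        rcases hgh with hgh | hgh
        · exact Or.inl hgh.symm
        · exact Or.inr (key _ _ hgh)
      trans := by
        have inv : ∀ x y : Γ, IsConj x y → IsConj x⁻¹ y⁻¹ := by
          intro x y h
          obtain ⟨c, hc⟩ := isConj_iff.1 h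
          refine isConj_iff.2 ⟨c, ?_⟩
          have h2 := congrArg (fun z => z⁻¹) hc
          simpa [mul_assoc] using h2
        intro g h k hgh hhk
        rcases hgh with hgh | hgh <;> rcases hhk with hhk | hhk
        · exact Or.inl (hgh.trans hhk)
        · exact Or.inr (hgh.trans hhk)
        · exact Or.inr (hgh.trans (inv _ _ hhk))
        · refine Or.inl (hgh.trans ?_)
          simpa using inv _ _ hhk }

/-- The set `Ω` of isotopy classes of unoriented essential simple closed curves in the once
punctured torus with fundamental group `Γ` (free of rank two). Such a class is the union of the
two conjugacy classes of a primitive element of `Γ` and of its inverse. -/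
def Omega (Γ : Type*) [Group Γ] : Type _ := Quotient (curveSetoid Γ)

/-- The trace `tr ρ(g)`. -/
def trace {Γ : Type*} [Group Γ] (ρ : Γ →* Matrix.SpecialLinearGroup (Fin 2) ℂ) (g : Γ) : ℂ :=
  Matrix.trace (ρ g : Matrix (Fin 2) (Fin 2) ℂ)

theorem trace_of_isConj {Γ : Type*} [Group Γ] (ρ : Γ →* Matrix.SpecialLinearGroup (Fin 2) ℂ)
    {g h : Γ} (hgh : IsConj g h) : trace ρ g = trace ρ h := by
  obtain ⟨c, rfl⟩ := isConj_iff.1 hgh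
  unfold trace
  rw [map_mul, map_mul, Matrix.SpecialLinearGroup.coe_mul, Matrix.trace_mul_comm,
    ← Matrix.SpecialLinearGroup.coe_mul, ← mul_assoc, ← map_mul, inv_mul_cancel, map_one, one_mul]

theorem trace_inv {Γ : Type*} [Group Γ] (ρ : Γ →* Matrix.SpecialLinearGroup (Fin 2) ℂ)
    (g : Γ) : trace ρ g⁻¹ = trace ρ g := by
  unfold trace
  rw [map_inv, Matrix.SpecialLinearGroup.coe_inv, Matrix.adjugate_fin_two, Matrix.trace_fin_two,
    Matrix.trace_fin_two]
  simp [add_comm]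

/-- The trace `tr ρ(X)` of a curve class `X ∈ Ω`. -/
def Omega.trace {Γ : Type*} [Group Γ] (ρ : Γ →* Matrix.SpecialLinearGroup (Fin 2) ℂ) :
    Omega Γ → ℂ :=
  Quotient.lift (fun g : {g : Γ // IsPrimitive g} => PuncturedTorus.trace ρ g.1) (by
    intro g h hgh
    rcases hgh with hgh | hgh
    · exact trace_of_isConj ρ hgh
    · exact (trace_of_isConj ρ hgh).trans (trace_inv ρ h.1))

/-- The `ℤ/2`-homology class `(r mod 2, s mod 2)` of an element of `Γ`, in the coordinates of the
free basis `(b 0, b 1)`: `b 0` has class `(1, 0)` and `b 1` has class `(0, 1)`. -/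
noncomputable def homologyModTwo {Γ : Type*} [Group Γ] (b : FreeGroupBasis (Fin 2) Γ) :
    Γ →* Multiplicative (ZMod 2 × ZMod 2) :=
  b.lift ![Multiplicative.ofAdd (1, 0), Multiplicative.ofAdd (0, 1)]

/-- The `ℤ/2`-homology class of a curve class `X ∈ Ω` (orientation is irrelevant mod 2). -/
noncomputable def Omega.homologyModTwo {Γ : Type*} [Group Γ] (b : FreeGroupBasis (Fin 2) Γ) :
    Omega Γ → ZMod 2 × ZMod 2 :=
  Quotient.lift
    (fun g : {g : Γ // IsPrimitive g} =>
      Multiplicative.toAdd (PuncturedTorus.homologyModTwo b g.1)) (by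
    have hconj : ∀ x y : Γ, IsConj x y →
        PuncturedTorus.homologyModTwo b x = PuncturedTorus.homologyModTwo b y := fun x y h =>
      isConj_iff_eq.1 ((PuncturedTorus.homologyModTwo b).map_isConj h)
    have hinv : ∀ z : ZMod 2 × ZMod 2, -z = z := by decide
    intro g h hgh
    rcases hgh with hgh | hgh
    · rw [hconj _ _ hgh]
    · rw [hconj _ _ hgh, map_inv, toAdd_inv, hinv])

/-- `Ω₁`: slope `s/r` with only `r` odd. -/
def Omega₁ {Γ : Type*} [Group Γ] (b : FreeGroupBasis (Fin 2) Γ) : Set (Omega Γ) :=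
  {X | X.homologyModTwo b = (1, 0)}

/-- `Ω₂`: slope `s/r` with only `s` odd. -/
def Omega₂ {Γ : Type*} [Group Γ] (b : FreeGroupBasis (Fin 2) Γ) : Set (Omega Γ) :=
  {X | X.homologyModTwo b = (0, 1)}

/-- `Ω₃`: slope `s/r` with `r` and `s` both odd. -/
def Omega₃ {Γ : Type*} [Group Γ] (b : FreeGroupBasis (Fin 2) Γ) : Set (Omega Γ) :=
  {X | X.homologyModTwo b = (1, 1)}

/-- `ρ` is irreducible: the only subspaces of `ℂ²` invariant under `ρ(Γ)` are `0` and `ℂ²`. -/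
def IsIrreducible {Γ : Type*} [Group Γ] (ρ : Γ →* Matrix.SpecialLinearGroup (Fin 2) ℂ) : Prop :=
  ∀ W : Submodule ℂ (Fin 2 → ℂ),
    (∀ g : Γ, ∀ v ∈ W, Matrix.mulVec (ρ g : Matrix (Fin 2) (Fin 2) ℂ) v ∈ W) → W = ⊥ ∨ W = ⊤

/-- The Bowditch conditions (i) and (ii). -/
structure BowditchConditions {Γ : Type*} [Group Γ]
    (ρ : Γ →* Matrix.SpecialLinearGroup (Fin 2) ℂ) : Prop where
  trace_notMem : ∀ X : Omega Γ, X.trace ρ ∉ Complex.ofReal '' Set.Icc (-2 : ℝ) 2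
  finite_small : {X : Omega Γ | ‖X.trace ρ‖ ≤ 2}.Finite

/-- The peripheral trace `τ = tr ρ(a b a⁻¹ b⁻¹)`, computed in the free basis `a = b 0`,
`b = b 1`. -/
def peripheralTrace {Γ : Type*} [Group Γ] (b : FreeGroupBasis (Fin 2) Γ)
    (ρ : Γ →* Matrix.SpecialLinearGroup (Fin 2) ℂ) : ℂ :=
  trace ρ (b 0 * b 1 * (b 0)⁻¹ * (b 1)⁻¹)

/-- The function `h_{μ,p}`. `Complex.sqrt` is the principal square root, with values in
`{z | 0 ≤ Re z}`; for `x ∉ [-2,2]` its argument here is never a negative real number. -/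
noncomputable def h (μ p x : ℂ) : ℂ :=
  1 / 2 * (1 - (x ^ 2 - (1 - p) * μ) / (x ^ 2 - μ) * Complex.sqrt (1 - 4 / x ^ 2))

end PuncturedTorus

namespace PuncturedTorus

/-- The length of the longest common prefix of two lists. -/
def commonPrefixLength {β : Type*} [DecidableEq β] : List β → List β → ℕ
  | a :: l, b :: m => if a = b then commonPrefixLength l m + 1 else 0
  | [], _ => 0
  | _ :: _, [] => 0

theorem le_commonPrefixLength_iff {β : Type*} [DecidableEq β] (k : ℕ) (l m : List β) :
    k ≤ commonPrefixLength l m ↔ k ≤ l.length ∧ k ≤ m.length ∧ l.take k = m.take k := by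
  induction k generalizing l m with
  | zero => simp
  | succ k ih =>
    cases l with
    | nil => simp [commonPrefixLength]
    | cons a l =>
      cases m with
      | nil => simp [commonPrefixLength]
      | cons b m =>
        by_cases hab : a = b
        · subst hab
          simp [commonPrefixLength, ih]
        · simp [commonPrefixLength, hab]

section FreeGroup

variable {α : Type*} [DecidableEq α]

theorem length_reduce_invRev_append (l m : List (α × Bool)) (hl : FreeGroup.IsReduced l)
    (hm : FreeGroup.IsReduced m) :
    (FreeGroup.reduce (FreeGroup.invRev l ++ m)).length + 2 * commonPrefixLength l m =
      l.length + m.length := by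
  induction l generalizing m with
  | nil => simp [commonPrefixLength, FreeGroup.invRev, hm.reduce_eq]
  | cons a l ih =>
    cases m with
    | nil =>
      simp [commonPrefixLength, FreeGroup.reduce_invRev, hl.reduce_eq, FreeGroup.invRev_length]
    | cons b m =>
      by_cases hab : a = b
      · subst hab
        have h1 : FreeGroup.reduce (FreeGroup.invRev (a :: l) ++ a :: m) =
            FreeGroup.reduce (FreeGroup.invRev l ++ m) := by
          apply FreeGroup.reduce.sound
          rw [← FreeGroup.mul_mk, ← FreeGroup.mul_mk, ← FreeGroup.inv_mk, ← FreeGroup.inv_mk,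
            ← List.singleton_append, ← List.singleton_append (l := m), ← FreeGroup.mul_mk,
            ← FreeGroup.mul_mk]
          group
        have := ih m (List.IsChain.tail hl) (List.IsChain.tail hm)
        rw [h1]
        simp only [commonPrefixLength, if_true, List.length_cons]
        omega
      · have hred : FreeGroup.IsReduced (FreeGroup.invRev (a :: l) ++ b :: m) := by
          have hi : FreeGroup.IsReduced (FreeGroup.invRev (a :: l)) := by
            rw [FreeGroup.isReduced_iff_reduce_eq, FreeGroup.reduce_invRev, hl.reduce_eq]
          unfold FreeGroup.IsReduced
          rw [List.isChain_append]
          refine ⟨hi, hm, ?_⟩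
          intro x hx y hy
          simp [FreeGroup.invRev] at hx hy
          subst hx hy
          intro h1
          simp only at h1 ⊢
          rcases a with ⟨a1, a2⟩
          rcases b with ⟨b1, b2⟩
          simp only at h1
          subst h1
          cases a2 <;> cases b2 <;> simp_all
        rw [hred.reduce_eq]
        simp [commonPrefixLength, hab, FreeGroup.invRev_length]

/-- The Gromov product of two elements of a free group based at `1`. -/
def gromov (x y : FreeGroup α) : ℕ := commonPrefixLength x.toWord y.toWord

theorem norm_inv_mul_add (x y : FreeGroup α) :
    (x⁻¹ * y).norm + 2 * gromov x y = x.norm + y.norm := by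
  have := length_reduce_invRev_append x.toWord y.toWord FreeGroup.isReduced_toWord
    FreeGroup.isReduced_toWord
  simpa [FreeGroup.norm, FreeGroup.toWord_mul, FreeGroup.toWord_inv, gromov] using this

theorem norm_mul_add (x y : FreeGroup α) :
    (x * y).norm + 2 * gromov x⁻¹ y = x.norm + y.norm := by
  have := norm_inv_mul_add x⁻¹ y
  simpa using this

theorem gromov_comm (x y : FreeGroup α) : gromov x y = gromov y x := by
  have h : ∀ l m : List (α × Bool), commonPrefixLength l m = commonPrefixLength m l := by
    intro l m
    apply le_antisymm
    · obtain ⟨h1, h2, h3⟩ := (le_commonPrefixLength_iff _ l m).1 le_rfl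
      exact (le_commonPrefixLength_iff _ _ _).2 ⟨h2, h1, h3.symm⟩
    · obtain ⟨h1, h2, h3⟩ := (le_commonPrefixLength_iff _ m l).1 le_rfl
      exact (le_commonPrefixLength_iff _ _ _).2 ⟨h2, h1, h3.symm⟩
  exact h _ _

theorem min_gromov_le (x y z : FreeGroup α) :
    min (gromov x y) (gromov y z) ≤ gromov x z := by
  obtain ⟨h1, h2, h3⟩ := (le_commonPrefixLength_iff _ _ _).1
    (min_le_left (gromov x y) (gromov y z))
  obtain ⟨h4, h5, h6⟩ := (le_commonPrefixLength_iff _ _ _).1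
    (min_le_right (gromov x y) (gromov y z))
  exact (le_commonPrefixLength_iff _ _ _).2 ⟨h1, h5, h3.trans h6⟩

theorem gromov_eq_of_lt {x y z : FreeGroup α} (h : gromov x y < gromov y z) :
    gromov x z = gromov x y := by
  have h1 := min_gromov_le x y z
  have h2 := min_gromov_le x z y
  rw [gromov_comm z y] at h2
  omega

/-- Cancellation in a square is strictly less than half. -/
theorem two_mul_gromov_inv_self_lt {x : FreeGroup α} (hx : x ≠ 1) :
    2 * gromov x⁻¹ x < x.norm := by
  by_contra! hcon
  obtain ⟨h1, h2, h3⟩ := (le_commonPrefixLength_iff (gromov x⁻¹ x) x⁻¹.toWord x.toWord).1 le_rfl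
  set k := gromov x⁻¹ x
  set w := x.toWord with hw
  have hwne : w.length ≠ 0 := by
    intro h0
    exact hx (FreeGroup.toWord_eq_nil_iff.1 (List.length_eq_zero_iff.1 h0))
  have hnorm : x.norm = w.length := rfl
  rw [hnorm] at hcon
  have hget : ∀ i, i < k → (x⁻¹.toWord)[i]? = w[i]? := by
    intro i hi
    have := congrArg (fun l => l[i]?) h3
    simpa [List.getElem?_take, hi] using this
  have hinv : ∀ i, i < w.length → (x⁻¹.toWord)[i]? =
      (w[w.length - 1 - i]?).map (fun g => (g.1, !g.2)) := by
    intro i hi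
    rw [FreeGroup.toWord_inv, FreeGroup.invRev, ← hw, List.getElem?_reverse (by simpa using hi)]
    simp
  have hred : FreeGroup.IsReduced w := FreeGroup.isReduced_toWord
  rcases Nat.even_or_odd' w.length with ⟨j, hj | hj⟩
  · have hj0 : 0 < j := by omega
    have e1 := hget (j - 1) (by omega)
    rw [hinv (j - 1) (by omega)] at e1
    have : w.length - 1 - (j - 1) = (j - 1) + 1 := by omega
    rw [this, List.getElem?_eq_getElem (by omega), List.getElem?_eq_getElem (by omega)] at e1
    have h5 := (List.isChain_iff_getElem.1 hred) (j - 1) (by omega)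
    simp only [Option.map_some, Option.some.injEq] at e1
    rw [← e1] at h5
    simp at h5
  · have e1 := hget j (by omega)
    rw [hinv j (by omega)] at e1
    have : w.length - 1 - j = j := by omega
    rw [this, List.getElem?_eq_getElem (by omega)] at e1
    simp only [Option.map_some, Option.some.injEq] at e1
    have := congrArg Prod.snd e1
    simp at this

/-- Words in a Nielsen reduced family are at least as long as the word. -/
theorem length_le_norm_of_nielsenReduced {β : Type*} (f : β × Bool → FreeGroup α)
    (h0 : ∀ p, f p ≠ 1)
    (h1 : ∀ p q : β × Bool, (p.1 = q.1 → p.2 = q.2) → 2 * gromov (f p)⁻¹ (f q) ≤ (f q).norm)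
    (h2 : ∀ p q r : β × Bool, (p.1 = q.1 → p.2 = q.2) → (q.1 = r.1 → q.2 = r.2) →
      gromov (f p)⁻¹ (f q) + gromov (f q)⁻¹ (f r) < (f q).norm)
    (L : List (β × Bool)) (hL : FreeGroup.IsReduced L) :
    L.length ≤ ((L.map f).prod).norm := by
  have key : ∀ (L : List (β × Bool)) (p : β × Bool), FreeGroup.IsReduced (p :: L) →
      ∀ q : β × Bool, (q.1 = p.1 → q.2 = p.2) →
      gromov (f q)⁻¹ (((p :: L).map f).prod) = gromov (f q)⁻¹ (f p) ∧
      (p :: L).length + gromov (f q)⁻¹ (f p) ≤ (((p :: L).map f).prod).norm := by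
    intro L
    induction L with
    | nil =>
      intro p _ q hq
      have h3 := h1 q p hq
      have h4 : (f p).norm ≠ 0 := fun h => h0 p (FreeGroup.norm_eq_zero.1 h)
      simp
      omega
    | cons p' L ih =>
      intro p hp q hq
      have hpp' : p.1 = p'.1 → p.2 = p'.2 := by
        have := hp
        unfold FreeGroup.IsReduced at this
        rw [List.isChain_cons_cons] at this
        exact this.1
      obtain ⟨i1, i2⟩ := ih p' (List.IsChain.tail hp) p hpp'
      set W := ((p' :: L).map f).prod with hW
      have hprod : ((p :: p' :: L).map f).prod = f p * W := by simp [hW]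
      rw [hprod]
      have n1 := norm_mul_add (f p) W
      have n2 := norm_inv_mul_add (f p) (f p * W)
      rw [inv_mul_cancel_left] at n2
      have n3 := h2 q p p' hq hpp'
      have n4 : gromov (f q)⁻¹ (f p * W) = gromov (f q)⁻¹ (f p) :=
        gromov_eq_of_lt (by omega)
      refine ⟨n4, ?_⟩
      simp only [List.length_cons] at i2 ⊢
      omega
  cases L with
  | nil => simp
  | cons p L => exact le_trans (by omega) (key L p hL p (fun _ => rfl)).2

end FreeGroup

/-- The pair `(s, t)` is a free basis of `Γ`. -/
def IsBasis {Γ : Type*} [Group Γ] (s t : Γ) : Prop :=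
  ∃ c : FreeGroupBasis (Fin 2) Γ, c 0 = s ∧ c 1 = t

namespace IsBasis

variable {Γ : Type*} [Group Γ] {s t : Γ}

theorem isPrimitive (h : IsBasis s t) : IsPrimitive s := by
  obtain ⟨c, rfl, rfl⟩ := h
  exact ⟨c, rfl⟩

theorem map {Δ : Type*} [Group Δ] (h : IsBasis s t) (e : Γ ≃* Δ) : IsBasis (e s) (e t) := by
  obtain ⟨c, rfl, rfl⟩ := h
  exact ⟨c.map e, rfl, rfl⟩

theorem conj (h : IsBasis s t) (g : Γ) : IsBasis (g * s * g⁻¹) (g * t * g⁻¹) := by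
  simpa using h.map (MulAut.conj g)

theorem swap (h : IsBasis s t) : IsBasis t s := by
  obtain ⟨c, rfl, rfl⟩ := h
  exact ⟨c.reindex (Equiv.swap 0 1), by simp, by simp⟩

theorem mul (h : IsBasis s t) : IsBasis (s * t) t := by
  obtain ⟨c, rfl, rfl⟩ := h
  have h1 : (c.lift ![c 0 * (c 1)⁻¹, c 1]).comp (c.lift ![c 0 * c 1, c 1]) = MonoidHom.id Γ := by
    apply c.ext_hom
    intro i
    fin_cases i <;> simp
  have h2 : (c.lift ![c 0 * c 1, c 1]).comp (c.lift ![c 0 * (c 1)⁻¹, c 1]) = MonoidHom.id Γ := by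
    apply c.ext_hom
    intro i
    fin_cases i <;> simp
  refine ⟨c.map (MonoidHom.toMulEquiv _ _ h1 h2), ?_, ?_⟩ <;> simp

theorem inv (h : IsBasis s t) : IsBasis s⁻¹ t := by
  obtain ⟨c, rfl, rfl⟩ := h
  have h1 : (c.lift ![(c 0)⁻¹, c 1]).comp (c.lift ![(c 0)⁻¹, c 1]) = MonoidHom.id Γ := by
    apply c.ext_hom
    intro i
    fin_cases i <;> simp
  refine ⟨c.map (MonoidHom.toMulEquiv _ _ h1 h1), ?_, ?_⟩ <;> simp

theorem inv_right (h : IsBasis s t) : IsBasis s t⁻¹ := h.swap.inv.swap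

theorem mul_right (h : IsBasis s t) : IsBasis s (s * t) := by
  have h2 := h.swap.inv.inv.mul.swap.conj s
  simpa [mul_assoc] using h2

end IsBasis

theorem exists_mul_eq_of_norm_eq {α : Type*} [DecidableEq α] (y : FreeGroup α) (k : ℕ)
    (hy : y.norm = 2 * k) : ∃ p q : FreeGroup α, y = p * q ∧ p.norm = k ∧ q.norm = k := by
  have h1 : FreeGroup.mk (y.toWord.take k) * FreeGroup.mk (y.toWord.drop k) = y := by
    rw [FreeGroup.mul_mk, List.take_append_drop, FreeGroup.mk_toWord]
  have h2 := FreeGroup.norm_mk_le (L₁ := y.toWord.take k)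
  have h3 := FreeGroup.norm_mk_le (L₁ := y.toWord.drop k)
  have h4 := FreeGroup.norm_mul_le (FreeGroup.mk (y.toWord.take k))
    (FreeGroup.mk (y.toWord.drop k))
  have h5 : y.toWord.length = 2 * k := hy
  rw [h1] at h4
  rw [List.length_take] at h2
  rw [List.length_drop] at h3
  exact ⟨_, _, h1.symm, by omega, by omega⟩

theorem freeGroup_basis_induction (P : FreeGroup (Fin 2) → FreeGroup (Fin 2) → Prop)
    (base : P (FreeGroup.of 0) (FreeGroup.of 1)) (swap : ∀ u v, P u v → P v u)
    (inv : ∀ u v, P u v → P u⁻¹ v) (mul : ∀ u v, P u v → P (u * v) v)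
    (conj : ∀ u v g, P u v → P (g * u * g⁻¹) (g * v * g⁻¹)) (u v : FreeGroup (Fin 2))
    (h : IsBasis u v) : P u v := by
  have unmul : ∀ u v, P (u * v) v → P u v := by
    intro u v h
    have := swap _ _ (inv _ _ (swap _ _ (mul _ _ (swap _ _ (inv _ _ (swap _ _ h))))))
    simpa using this
  have unconj : ∀ u v g, P (g * u * g⁻¹) (g * v * g⁻¹) → P u v := by
    intro u v g h
    have := conj _ _ g⁻¹ h
    simpa [mul_assoc] using this
  induction hn : u.norm + v.norm using Nat.strong_induction_on generalizing u v with
  | _ n ih =>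
  by_contra hP
  let V : FreeGroup (Fin 2) → FreeGroup (Fin 2) → Prop :=
    fun x y => IsBasis x y ∧ ¬ P x y ∧ x.norm + y.norm = n
  have Vswap : ∀ x y, V x y → V y x := fun x y ⟨h1, h2, h3⟩ =>
    ⟨h1.swap, fun h => h2 (swap _ _ h), by omega⟩
  have Vinv : ∀ x y, V x y → V x⁻¹ y := fun x y ⟨h1, h2, h3⟩ =>
    ⟨h1.inv, fun h => h2 (by simpa using inv _ _ h), by rw [FreeGroup.norm_inv_eq]; omega⟩
  have Vle : ∀ x y, V x y → x.norm ≤ (x * y).norm := by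
    intro x y ⟨h1, h2, h3⟩
    by_contra! hlt
    exact h2 (unmul _ _ (ih _ (by omega) (x * y) y h1.mul rfl))
  have Vle' : ∀ x y, V x y → y.norm ≤ (x * y).norm := by
    intro x y hxy
    have := Vle _ _ (Vinv _ _ (Vswap _ _ (Vinv _ _ hxy)))
    rwa [← mul_inv_rev, FreeGroup.norm_inv_eq, FreeGroup.norm_inv_eq] at this
  have Vhalf : ∀ x y, V x y → 2 * gromov x⁻¹ y ≤ x.norm ∧ 2 * gromov x⁻¹ y ≤ y.norm := by
    intro x y hxy
    have h1 := Vle _ _ hxy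
    have h2 := Vle' _ _ hxy
    have h3 := norm_mul_add x y
    omega
  have Vtie : ∀ x y, V x y → y ≠ 1 → y.norm = 2 * gromov x⁻¹ y →
      y.norm = 2 * gromov y⁻¹ x → False := by
    intro x y hxy hy1 e1 e2
    have hx := Vhalf x y hxy
    set k := gromov x⁻¹ y with hk
    obtain ⟨p, q, hpq, hp, hq⟩ := exists_mul_eq_of_norm_eq y k e1
    have hk0 : k ≠ 0 := by
      intro h0
      rw [h0] at e1
      exact hy1 (FreeGroup.norm_eq_zero.1 e1)
    have g1 : gromov y p = k := by
      have := norm_inv_mul_add y p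
      rw [hpq, mul_inv_rev, mul_assoc, inv_mul_cancel, mul_one, FreeGroup.norm_inv_eq,
        ← hpq] at this
      omega
    have g2 : gromov y⁻¹ q⁻¹ = k := by
      have := norm_inv_mul_add y⁻¹ q⁻¹
      rw [inv_inv, hpq, mul_assoc, mul_inv_cancel, mul_one, FreeGroup.norm_inv_eq,
        FreeGroup.norm_inv_eq, ← hpq] at this
      omega
    have g3 : k ≤ gromov x⁻¹ p := by
      have := min_gromov_le x⁻¹ y p
      omega
    have g4 : k ≤ gromov q⁻¹ x := by
      have := min_gromov_le q⁻¹ y⁻¹ x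
      rw [gromov_comm q⁻¹ y⁻¹] at this
      omega
    have n1 := norm_mul_add q x
    have n2 := norm_inv_mul_add (x⁻¹ * q⁻¹) x⁻¹
    have e3 : (x⁻¹ * q⁻¹)⁻¹ * x⁻¹ = q := by group
    have e4 : (x⁻¹ * q⁻¹).norm = (q * x).norm := by
      rw [← FreeGroup.norm_inv_eq, mul_inv_rev, inv_inv, inv_inv]
    rw [e3, e4, FreeGroup.norm_inv_eq] at n2
    have g5 := min_gromov_le (x⁻¹ * q⁻¹) x⁻¹ p
    have n3 := norm_mul_add (q * x) p
    rw [mul_inv_rev] at n3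
    have c1 : (p⁻¹ * y) * (x * y) * (p⁻¹ * y)⁻¹ = q * x * p := by
      rw [hpq]; group
    have c2 : (p⁻¹ * y) * y * (p⁻¹ * y)⁻¹ = q * p := by
      rw [hpq]; group
    have n4 := FreeGroup.norm_mul_le q p
    obtain ⟨h1, h2, h3⟩ := hxy
    have hb := h1.mul.conj (p⁻¹ * y)
    rw [c1, c2] at hb
    have hfin := ih _ (by omega) _ _ hb rfl
    rw [← c1, ← c2] at hfin
    exact h2 (unmul _ _ (unconj _ _ _ hfin))
  have Vuv : V u v := ⟨h, hP, hn⟩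
  let f : Fin 2 × Bool → FreeGroup (Fin 2) := fun p =>
    cond p.2 (![u, v] p.1) (![u, v] p.1)⁻¹
  have Vinv2 : ∀ x y, V x y → V x y⁻¹ := fun x y hxy => Vswap _ _ (Vinv _ _ (Vswap _ _ hxy))
  have Vf : ∀ p q : Fin 2 × Bool, p.1 ≠ q.1 → V (f p) (f q) := by
    have Vvu := Vswap _ _ Vuv
    rintro ⟨i, x⟩ ⟨j, y⟩ hij
    fin_cases i <;> fin_cases j <;> first | exact absurd rfl hij | skip
    · cases x <;> cases y
      · exact Vinv _ _ (Vinv2 _ _ Vuv)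
      · exact Vinv _ _ Vuv
      · exact Vinv2 _ _ Vuv
      · exact Vuv
    · cases x <;> cases y
      · exact Vinv _ _ (Vinv2 _ _ Vvu)
      · exact Vinv _ _ Vvu
      · exact Vinv2 _ _ Vvu
      · exact Vvu
  have ne1 : ∀ x y : FreeGroup (Fin 2), IsBasis x y → x ≠ 1 := by
    rintro x y ⟨c, rfl, rfl⟩ hc
    have := congrArg c.repr hc
    rw [c.repr_apply_coe, map_one] at this
    exact FreeGroup.of_ne_one _ this
  have hf1 : ∀ p, f p ≠ 1 := by
    rintro ⟨i, x⟩
    fin_cases i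
    · exact ne1 _ _ (Vf (0, x) (1, x) (by simp)).1
    · exact ne1 _ _ (Vf (1, x) (0, x) (by simp)).1
  have H1 : ∀ p q : Fin 2 × Bool, (p.1 = q.1 → p.2 = q.2) →
      2 * gromov (f p)⁻¹ (f q) ≤ (f q).norm := by
    intro p q hpq
    by_cases hc : p.1 = q.1
    · obtain rfl : p = q := Prod.ext hc (hpq hc)
      exact (two_mul_gromov_inv_self_lt (hf1 p)).le
    · exact (Vhalf _ _ (Vf p q hc)).2
  have H1' : ∀ p q : Fin 2 × Bool, (p.1 = q.1 → p.2 = q.2) →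
      2 * gromov (f p)⁻¹ (f q) ≤ (f p).norm := by
    intro p q hpq
    by_cases hc : p.1 = q.1
    · obtain rfl : p = q := Prod.ext hc (hpq hc)
      exact (two_mul_gromov_inv_self_lt (hf1 p)).le
    · exact (Vhalf _ _ (Vf p q hc)).1
  have H2 : ∀ p q r : Fin 2 × Bool, (p.1 = q.1 → p.2 = q.2) → (q.1 = r.1 → q.2 = r.2) →
      gromov (f p)⁻¹ (f q) + gromov (f q)⁻¹ (f r) < (f q).norm := by
    intro p q r hpq hqr
    by_contra! hcon
    have a1 := H1 p q hpq
    have a2 := H1' q r hqr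
    have a0 := two_mul_gromov_inv_self_lt (hf1 q)
    have hpq' : p.1 ≠ q.1 := by
      intro hc
      obtain rfl : p = q := Prod.ext hc (hpq hc)
      omega
    have hqr' : q.1 ≠ r.1 := by
      intro hc
      obtain rfl : q = r := Prod.ext hc (hqr hc)
      omega
    have hpr : p.1 = r.1 := by omega
    by_cases hs : p.2 = r.2
    · obtain rfl : p = r := Prod.ext hpr hs
      exact Vtie (f p) (f q) (Vf p q hpq') (hf1 q) (by omega) (by omega)
    · have hfr : f r = (f p)⁻¹ := by
        obtain ⟨i, x⟩ := p
        obtain ⟨j, y⟩ := r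
        simp only at hpr hs
        subst hpr
        cases x <;> cases y
        · exact absurd rfl hs
        · simp [f]
        · simp [f]
        · exact absurd rfl hs
      rw [hfr] at a2 hcon
      have := min_gromov_le (f q)⁻¹ (f p)⁻¹ (f q)
      omega
  have H3 := length_le_norm_of_nielsenReduced f hf1 H1 H2
  have H4 : ∀ i : Fin 2, ∃ p, FreeGroup.of i = f p := by
    intro i
    obtain ⟨c, hc0, hc1⟩ := h
    have hc : (fun i => c i) = ![u, v] := by
      funext j
      fin_cases j
      · exact hc0
      · exact hc1
    set W := c.repr (FreeGroup.of i) with hW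
    have e1 : (W.toWord.map f).prod = FreeGroup.of i := by
      have e2 : FreeGroup.lift (fun i => c i) W = FreeGroup.of i := by
        have e3 : FreeGroup.lift (fun i => c i) = c.repr.symm.toMonoidHom := by
          ext j
          simp
          rfl
        rw [e3, hW]
        simp
      rw [← FreeGroup.mk_toWord (x := W), hc, FreeGroup.lift_mk] at e2
      exact e2
    have e4 := H3 W.toWord FreeGroup.isReduced_toWord
    rw [e1, FreeGroup.norm_of] at e4
    rcases hw : W.toWord with _ | ⟨p, _ | ⟨q, L⟩⟩
    · rw [hw] at e1
      simp at e1
    · rw [hw] at e1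
      simp at e1
      exact ⟨p, e1.symm⟩
    · rw [hw] at e4
      simp at e4
  obtain ⟨p, hp⟩ := H4 0
  obtain ⟨q, hq⟩ := H4 1
  have hpq : p.1 ≠ q.1 := by
    intro hc
    have h01 : (FreeGroup.of 0 : FreeGroup (Fin 2)) ≠ FreeGroup.of 1 := by decide
    have h01' : (FreeGroup.of 0 : FreeGroup (Fin 2)) ≠ (FreeGroup.of 1)⁻¹ := by decide
    obtain ⟨i, x⟩ := p
    obtain ⟨j, y⟩ := q
    simp only at hc
    subst hc
    cases x <;> cases y <;> simp only [f, cond_true, cond_false] at hp hq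
    · exact h01 (hp.trans hq.symm)
    · exact h01' (by rw [hp, hq])
    · exact h01' (by rw [hp, hq, inv_inv])
    · exact h01 (hp.trans hq.symm)
  have := (Vf p q hpq).2.1
  rw [← hp, ← hq] at this
  exact this base

/-- Nielsen: all free bases of a free group of rank two are obtained from one of them by
elementary moves and conjugation. -/
theorem basis_induction {Γ : Type*} [Group Γ] (b : FreeGroupBasis (Fin 2) Γ) (P : Γ → Γ → Prop)
    (base : P (b 0) (b 1)) (swap : ∀ u v, P u v → P v u)
    (inv : ∀ u v, P u v → P u⁻¹ v) (mul : ∀ u v, P u v → P (u * v) v)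
    (conj : ∀ u v g, P u v → P (g * u * g⁻¹) (g * v * g⁻¹)) (u v : Γ)
    (h : IsBasis u v) : P u v := by
  have := freeGroup_basis_induction (fun x y => P (b.repr.symm x) (b.repr.symm y)) base
    (fun u v => swap _ _) (fun u v h => by simpa using inv _ _ h)
    (fun u v h => by simpa using mul _ _ h)
    (fun u v g h => by simpa using conj _ _ (b.repr.symm g) h) (b.repr u) (b.repr v)
    (h.map b.repr)
  simpa using this

/-- The node of a binary tree reached from `e` by following the directions in `w`. -/
def descend {S : Type*} (step : Bool → S → S) (w : List Bool) (e : S) : S :=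
  w.foldl (fun e d => step d e) e

section descend

variable {S : Type*} (step : Bool → S → S)

@[simp] theorem descend_nil (e : S) : descend step [] e = e := rfl

@[simp] theorem descend_cons (d : Bool) (w : List Bool) (e : S) :
    descend step (d :: w) e = descend step w (step d e) := rfl

theorem descend_concat (w : List Bool) (d : Bool) (e : S) :
    descend step (w ++ [d]) e = step d (descend step w e) := by
  simp [descend]

end descend

section Group

variable {Γ : Type*} [Group Γ]

/-- The two pairs following `(s, t)` in the tree of bases. -/
def pairStep : Bool → Γ × Γ → Γ × Γ
  | false, e => (e.1, e.1 * e.2)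
  | true, e => (e.2, e.1 * e.2)

theorem IsBasis.pairStep {e : Γ × Γ} (h : IsBasis e.1 e.2) (d : Bool) :
    IsBasis (pairStep d e).1 (pairStep d e).2 := by
  cases d
  · exact h.mul_right
  · exact h.mul.swap

theorem IsBasis.descend {e : Γ × Γ} (h : IsBasis e.1 e.2) (w : List Bool) :
    IsBasis (descend PuncturedTorus.pairStep w e).1 (descend PuncturedTorus.pairStep w e).2 := by
  induction w generalizing e with
  | nil => exact h
  | cons d w ih => exact ih (h.pairStep d)

/-- The exponents in homology of the word at a node of the tree of bases. -/
def slope : List Bool → ℕ × ℕ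
  | [] => (1, 1)
  | false :: w => ((slope w).1 + (slope w).2, (slope w).2)
  | true :: w => ((slope w).2, (slope w).1 + (slope w).2)

theorem slope_pos (w : List Bool) : 0 < (slope w).1 ∧ 0 < (slope w).2 := by
  induction w with
  | nil => simp [slope]
  | cons d w ih => cases d <;> simp only [slope] <;> omega

theorem slope_injective : Function.Injective slope := by
  intro w
  induction w with
  | nil =>
    intro w' h
    rcases w' with _ | ⟨d, w'⟩
    · rfl
    · have := slope_pos w'
      cases d <;> simp only [slope, Prod.ext_iff] at h <;> omega
  | cons d w ih =>
    intro w' h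
    have h1 := slope_pos w
    rcases w' with _ | ⟨d', w'⟩
    · cases d <;> simp only [slope, Prod.ext_iff] at h <;> omega
    · have h2 := slope_pos w'
      have h3 : d = d' := by
        cases d <;> cases d' <;> first | rfl | (simp only [slope, Prod.ext_iff] at h; omega)
      subst h3
      rw [ih (a₂ := w')]
      cases d <;> simp only [slope, Prod.ext_iff] at h ⊢ <;> omega

theorem map_descend_pairStep {A : Type*} [CommGroup A] (φ : Γ →* A) (w : List Bool) (e : Γ × Γ) :
    φ ((descend pairStep w e).1 * (descend pairStep w e).2) =
      φ e.1 ^ (slope w).1 * φ e.2 ^ (slope w).2 := by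
  induction w generalizing e with
  | nil => simp [slope]
  | cons d w ih =>
    rw [descend_cons, ih]
    cases d
    · simp only [pairStep, slope, map_mul, mul_pow, pow_add, mul_assoc]
    · simp only [pairStep, slope, map_mul, mul_pow, pow_add]
      exact mul_left_comm _ _ _

/-- The root pairs of the two halves of the tree of bases. -/
def rootPair (b : FreeGroupBasis (Fin 2) Γ) : Bool → Γ × Γ
  | false => (b 0, b 1)
  | true => (b 0, (b 1)⁻¹)

theorem isBasis_rootPair (b : FreeGroupBasis (Fin 2) Γ) (d : Bool) :
    IsBasis (rootPair b d).1 (rootPair b d).2 := by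
  have h : IsBasis (b 0) (b 1) := ⟨b, rfl, rfl⟩
  cases d
  · exact h
  · exact h.inv_right

/-- The index set of `Ω`: the two generators, and two binary trees of products. -/
abbrev CurveIndex := Fin 2 ⊕ (Bool × List Bool)

/-- The primitive element with a given index. -/
def curveWord (b : FreeGroupBasis (Fin 2) Γ) : CurveIndex → Γ
  | Sum.inl i => b i
  | Sum.inr (d, w) =>
    (descend pairStep w (rootPair b d)).1 * (descend pairStep w (rootPair b d)).2

theorem isPrimitive_curveWord (b : FreeGroupBasis (Fin 2) Γ) (i : CurveIndex) :
    IsPrimitive (curveWord b i) := by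
  have h : IsBasis (b 0) (b 1) := ⟨b, rfl, rfl⟩
  rcases i with i | ⟨d, w⟩
  · fin_cases i
    · exact h.isPrimitive
    · exact h.swap.isPrimitive
  · exact ((isBasis_rootPair b d).descend w).mul.isPrimitive

/-- The curve with a given index. -/
def curve (b : FreeGroupBasis (Fin 2) Γ) (i : CurveIndex) : Omega Γ :=
  Quotient.mk (curveSetoid Γ) ⟨curveWord b i, isPrimitive_curveWord b i⟩

theorem map_eq_or_of_curve_eq {A : Type*} [CommGroup A] (φ : Γ →* A)
    (b : FreeGroupBasis (Fin 2) Γ) {i j : CurveIndex} (h : curve b i = curve b j) :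
    φ (curveWord b i) = φ (curveWord b j) ∨ φ (curveWord b i) = (φ (curveWord b j))⁻¹ := by
  rcases Quotient.exact h with h | h
  · exact Or.inl (isConj_iff_eq.1 (φ.map_isConj h))
  · right
    rw [← map_inv]
    exact isConj_iff_eq.1 (φ.map_isConj h)

theorem curve_injective (b : FreeGroupBasis (Fin 2) Γ) : Function.Injective (curve b) := by
  intro i j hij
  let φ : Γ →* Multiplicative (ℤ × ℤ) :=
    b.lift ![Multiplicative.ofAdd (1, 0), Multiplicative.ofAdd (0, 1)]
  have h0 : φ (b 0) = Multiplicative.ofAdd (1, 0) := by simp [φ]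
  have h1 : φ (b 1) = Multiplicative.ofAdd (0, 1) := by simp [φ]
  have key : ∀ i : CurveIndex, Multiplicative.toAdd (φ (curveWord b i)) =
      (match i with
        | Sum.inl 0 => ((1 : ℤ), (0 : ℤ))
        | Sum.inl 1 => (0, 1)
        | Sum.inr (false, w) => (((slope w).1 : ℤ), ((slope w).2 : ℤ))
        | Sum.inr (true, w) => (((slope w).1 : ℤ), -((slope w).2 : ℤ))) := by
    intro i
    rcases i with i | ⟨d, w⟩
    · fin_cases i
      · simp [curveWord, h0]
      · simp [curveWord, h1]
    · cases d <;> simp only [curveWord, map_descend_pairStep, rootPair, map_inv, h0, h1] <;> simp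
  have h2 : Multiplicative.toAdd (φ (curveWord b i)) = Multiplicative.toAdd (φ (curveWord b j)) ∨
      Multiplicative.toAdd (φ (curveWord b i)) = -Multiplicative.toAdd (φ (curveWord b j)) := by
    rcases map_eq_or_of_curve_eq φ b hij with h | h
    · exact Or.inl (by rw [h])
    · exact Or.inr (by rw [h, toAdd_inv])
  rw [key, key] at h2
  rcases i with i | ⟨d, w⟩ <;> rcases j with j | ⟨d', w'⟩
  · fin_cases i <;> fin_cases j <;> simp at h2 ⊢
  · have := slope_pos w'
    fin_cases i <;> cases d' <;> simp [Prod.ext_iff] at h2 <;> omega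
  · have := slope_pos w
    fin_cases j <;> cases d <;> simp [Prod.ext_iff] at h2 <;> omega
  · have p1 := slope_pos w
    have p2 := slope_pos w'
    have h3 : d = d' := by
      cases d <;> cases d' <;> first | rfl | (simp [Prod.ext_iff] at h2; omega)
    subst h3
    rw [slope_injective (a₁ := w) (a₂ := w')]
    cases d <;> simp [Prod.ext_iff] at h2 ⊢ <;> omega

/-- Pairs obtained from nodes of the tree by conjugation, exchange and inversion. -/
inductive IsFareyPair (b : FreeGroupBasis (Fin 2) Γ) : Γ → Γ → Prop
  | node (d : Bool) (w : List Bool) : IsFareyPair b (descend pairStep w (rootPair b d)).1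
      (descend pairStep w (rootPair b d)).2
  | swap (u v : Γ) : IsFareyPair b u v → IsFareyPair b v u
  | inv (u v : Γ) : IsFareyPair b u v → IsFareyPair b u⁻¹ v
  | conj (u v g : Γ) : IsFareyPair b u v → IsFareyPair b (g * u * g⁻¹) (g * v * g⁻¹)

namespace IsFareyPair

variable {b : FreeGroupBasis (Fin 2) Γ} {u v : Γ}

theorem of_conj (g : Γ) (h : IsFareyPair b (g * u * g⁻¹) (g * v * g⁻¹)) : IsFareyPair b u v := by
  have := h.conj _ _ g⁻¹
  simpa [mul_assoc] using this

theorem of_inv (h : IsFareyPair b u⁻¹ v) : IsFareyPair b u v := by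
  simpa using h.inv

theorem of_inv_right (h : IsFareyPair b u v⁻¹) : IsFareyPair b u v :=
  h.swap.of_inv.swap

theorem step_node (d : Bool) (w : List Bool) :
    let e := descend pairStep w (rootPair b d)
    IsFareyPair b (e.1 * e.2) e.2 ∧ IsFareyPair b (e.1 * e.2) e.1 := by
  have h1 := IsFareyPair.node (b := b) d (w ++ [false])
  have h2 := IsFareyPair.node (b := b) d (w ++ [true])
  rw [descend_concat] at h1 h2
  exact ⟨h2.swap, h1.swap⟩

theorem mul_node (d : Bool) (w : List Bool) :
    let e := descend pairStep w (rootPair b d)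
    IsFareyPair b (e.1⁻¹ * e.2) e.2 ∧ IsFareyPair b (e.1⁻¹ * e.2) e.1 := by
  induction w using List.reverseRecOn with
  | nil =>
    obtain ⟨h1, h2⟩ := step_node (b := b) (!d) []
    have hroot : rootPair b (!d) = ((rootPair b d).1, (rootPair b d).2⁻¹) := by
      cases d <;> simp [rootPair]
    simp only [descend_nil, hroot] at h1 h2 ⊢
    set s := (rootPair b d).1
    set t := (rootPair b d).2
    constructor
    · apply of_conj t
      apply of_inv
      have e1 : (t * (s⁻¹ * t) * t⁻¹)⁻¹ = s * t⁻¹ := by group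
      have e2 : t * t * t⁻¹ = t := by group
      rw [e1, e2]
      exact h1.of_inv_right
    · apply of_conj s
      apply of_inv
      have e1 : (s * (s⁻¹ * t) * s⁻¹)⁻¹ = s * t⁻¹ := by group
      have e2 : s * s * s⁻¹ = s := by group
      rw [e1, e2]
      exact h2
  | append_singleton w d' ih =>
    have h0 := IsFareyPair.node (b := b) d w
    obtain ⟨h1, h2⟩ := step_node (b := b) d w
    simp only [descend_concat]
    set s := (descend pairStep w (rootPair b d)).1
    set t := (descend pairStep w (rootPair b d)).2
    cases d' <;> simp only [pairStep]
    · rw [inv_mul_cancel_left]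
      exact ⟨h1.swap, h0.swap⟩
    · constructor
      · apply of_conj (s * t)
        have e1 : s * t * (t⁻¹ * (s * t)) * (s * t)⁻¹ = s := by group
        have e2 : s * t * (s * t) * (s * t)⁻¹ = s * t := by group
        rw [e1, e2]
        exact h2.swap
      · apply of_conj t
        have e1 : t * (t⁻¹ * (s * t)) * t⁻¹ = s := by group
        have e2 : t * t * t⁻¹ = t := by group
        rw [e1, e2]
        exact h0

theorem mul_aux (h : IsFareyPair b u v) :
    (IsFareyPair b (u * v) v ∧ IsFareyPair b (u * v) u) ∧
      (IsFareyPair b (u⁻¹ * v) v ∧ IsFareyPair b (u⁻¹ * v) u) := by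
  induction h with
  | node d w => exact ⟨step_node d w, mul_node d w⟩
  | swap u v _ ih =>
    obtain ⟨⟨h1, h2⟩, h3, h4⟩ := ih
    refine ⟨⟨?_, ?_⟩, ?_, ?_⟩
    · simpa [mul_assoc] using h2.conj _ _ u⁻¹
    · simpa [mul_assoc] using h1.conj _ _ v
    · simpa [mul_assoc] using h4.inv
    · simpa [mul_assoc] using h3.inv
  | inv u v _ ih =>
    obtain ⟨⟨h1, h2⟩, h3, h4⟩ := ih
    exact ⟨⟨h3, h4.swap.inv.swap⟩, by simpa using h1, by simpa using h2.swap.inv.swap⟩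
  | conj u v g _ ih =>
    obtain ⟨⟨h1, h2⟩, h3, h4⟩ := ih
    refine ⟨⟨?_, ?_⟩, ?_, ?_⟩
    · simpa [mul_assoc] using h1.conj _ _ g
    · simpa [mul_assoc] using h2.conj _ _ g
    · simpa [mul_assoc] using h3.conj _ _ g
    · simpa [mul_assoc] using h4.conj _ _ g

theorem of_isBasis (h : IsBasis u v) : IsFareyPair b u v :=
  basis_induction b (IsFareyPair b) (IsFareyPair.node false []) IsFareyPair.swap IsFareyPair.inv
    (fun _ _ h => h.mul_aux.1.1) IsFareyPair.conj u v h

theorem exists_isConj (h : IsFareyPair b u v) :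
    (∃ i, IsConj u (curveWord b i) ∨ IsConj u (curveWord b i)⁻¹) ∧
      (∃ i, IsConj v (curveWord b i) ∨ IsConj v (curveWord b i)⁻¹) := by
  have inv : ∀ x y : Γ, IsConj x y → IsConj x⁻¹ y⁻¹ := by
    intro x y h
    obtain ⟨c, rfl⟩ := isConj_iff.1 h
    exact isConj_iff.2 ⟨c, by group⟩
  induction h with
  | node d w =>
    induction w using List.reverseRecOn with
    | nil =>
      refine ⟨⟨Sum.inl 0, Or.inl ?_⟩, ⟨Sum.inl 1, ?_⟩⟩
      · cases d <;> exact IsConj.refl _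
      · cases d
        · exact Or.inl (IsConj.refl _)
        · exact Or.inr (IsConj.refl _)
    | append_singleton w d' ih =>
      rw [descend_concat]
      cases d'
      · exact ⟨ih.1, Sum.inr (d, w), Or.inl (IsConj.refl _)⟩
      · exact ⟨ih.2, Sum.inr (d, w), Or.inl (IsConj.refl _)⟩
  | swap u v _ ih => exact ih.symm
  | inv u v _ ih =>
    obtain ⟨⟨i, hi⟩, h2⟩ := ih
    refine ⟨⟨i, ?_⟩, h2⟩
    rcases hi with hi | hi
    · exact Or.inr (inv _ _ hi)
    · exact Or.inl (by simpa using inv _ _ hi)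
  | conj u v g _ ih =>
    obtain ⟨⟨i, hi⟩, j, hj⟩ := ih
    have hc : ∀ x, IsConj (g * x * g⁻¹) x := fun x => (isConj_iff.2 ⟨g, rfl⟩).symm
    exact ⟨⟨i, hi.imp (hc u).trans (hc u).trans⟩, ⟨j, hj.imp (hc v).trans (hc v).trans⟩⟩

end IsFareyPair

theorem curve_surjective (b : FreeGroupBasis (Fin 2) Γ) : Function.Surjective (curve b) := by
  intro X
  induction X using Quotient.inductionOn with
  | _ g =>
    obtain ⟨g, c, rfl⟩ := g
    obtain ⟨i, hi⟩ := (IsFareyPair.of_isBasis (b := b) ⟨c, rfl, rfl⟩).exists_isConj.1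
    exact ⟨i, (Quotient.sound hi).symm⟩

/-- The parametrization of `Ω` by a pair of binary trees. -/
noncomputable def curveEquiv (b : FreeGroupBasis (Fin 2) Γ) : CurveIndex ≃ Omega Γ :=
  Equiv.ofBijective (curve b) ⟨curve_injective b, curve_surjective b⟩

end Group

section TreeSum

variable {S : Type*} (step : Bool → S → S)

/-- The sum of a function over the first `n` levels of the binary tree rooted at `e`. -/
def levelSum (f : S → ℝ) : ℕ → S → ℝ
  | 0, _ => 0
  | n + 1, e => f e + (levelSum f n (step false e) + levelSum f n (step true e))

/-- A word is empty or begins with one of the two letters. -/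
def listBoolEquiv : Unit ⊕ (List Bool ⊕ List Bool) ≃ List Bool where
  toFun
    | Sum.inl _ => []
    | Sum.inr (Sum.inl w) => false :: w
    | Sum.inr (Sum.inr w) => true :: w
  invFun
    | [] => Sum.inl ()
    | false :: w => Sum.inr (Sum.inl w)
    | true :: w => Sum.inr (Sum.inr w)
  left_inv o := by rcases o with _ | w | w <;> rfl
  right_inv w := by rcases w with _ | ⟨_ | _, w⟩ <;> rfl

/-- The words of length less than `n`. -/
def shortWords : ℕ → Finset (List Bool)
  | 0 => ∅
  | n + 1 => insert [] ((shortWords n).image (List.cons false) ∪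
      (shortWords n).image (List.cons true))

theorem mem_shortWords (n : ℕ) (w : List Bool) : w ∈ shortWords n ↔ w.length < n := by
  induction n generalizing w with
  | zero => simp [shortWords]
  | succ n ih =>
    rcases w with _ | ⟨d, w⟩
    · simp [shortWords]
    · cases d <;> simp [shortWords, ih]

theorem sum_shortWords (f : S → ℝ) (n : ℕ) (e : S) :
    ∑ w ∈ shortWords n, f (descend step w e) = levelSum step f n e := by
  induction n generalizing e with
  | zero => rfl
  | succ n ih =>
    rw [shortWords, Finset.sum_insert (by simp), Finset.sum_union, Finset.sum_image, Finset.sum_image]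
    · simp [levelSum, ih]
    · simp
    · simp
    · rw [Finset.disjoint_left]
      simp

variable {step}

theorem summable_and_tsum_le_of_levelSum_le {f : S → ℝ} (hf : ∀ e, 0 ≤ f e) {e : S} {M : ℝ}
    (h : ∀ n, levelSum step f n e ≤ M) :
    Summable (fun w => f (descend step w e)) ∧ ∑' w, f (descend step w e) ≤ M := by
  have key : ∀ s : Finset (List Bool), ∑ w ∈ s, f (descend step w e) ≤ M := by
    intro s
    refine le_trans ?_ (h (s.sup List.length + 1))
    rw [← sum_shortWords]
    apply Finset.sum_le_sum_of_subset_of_nonneg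
    · intro w hw
      rw [mem_shortWords]
      exact Nat.lt_succ_of_le (Finset.le_sup (f := List.length) hw)
    · intros
      exact hf _
  have h1 := summable_of_sum_le (fun w => hf (descend step w e)) key
  exact ⟨h1, h1.tsum_le_of_sum_le key⟩

theorem hasSum_descend {f : S → ℂ} {e : S} {a b : ℂ}
    (ha : HasSum (fun w => f (descend step w (step false e))) a)
    (hb : HasSum (fun w => f (descend step w (step true e))) b) :
    HasSum (fun w => f (descend step w e)) (f e + (a + b)) := by
  rw [← listBoolEquiv.hasSum_iff]
  exact HasSum.sum (hasSum_unique _) (HasSum.sum ha hb)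

theorem levelSum_mono_of_le {f g : S → ℝ} {G : S → Prop} (hG : ∀ e d, G e → G (step d e))
    (h : ∀ e, G e → f e ≤ g e) (n : ℕ) {e : S} (he : G e) :
    levelSum step f n e ≤ levelSum step g n e := by
  induction n generalizing e with
  | zero => exact le_rfl
  | succ n ih => exact add_le_add (h e he) (add_le_add (ih (hG e _ he)) (ih (hG e _ he)))

theorem levelSum_const_mul (c : ℝ) (f : S → ℝ) (n : ℕ) (e : S) :
    levelSum step (fun e => c * f e) n e = c * levelSum step f n e := by
  induction n generalizing e with
  | zero => simp [levelSum]
  | succ n ih => simp only [levelSum, ih]; ring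

/-- A function on a hereditary set of nodes which is controlled by a summable weight is the sum
of its defects. -/
theorem hasSum_of_levelSum_le {f g : S → ℂ} {W M : S → ℝ} {G : S → Prop} {K K' : ℝ}
    (hG : ∀ e d, G e → G (step d e))
    (hrec : ∀ e, G e → g e = f e + (g (step false e) + g (step true e)))
    (hK : 0 ≤ K) (hK' : 0 ≤ K') (hg : ∀ e, G e → ‖g e‖ ≤ K * W e)
    (hWs : ∀ e d, G e → W (step d e) ≤ W e)
    (hWM : ∀ e, G e → ∀ n, levelSum step W n e ≤ M e) (hMW : ∀ e, G e → M e ≤ K' * W e)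
    {e : S} (he : G e) :
    HasSum (fun w => f (descend step w e)) (g e) ∧
      ∀ n, levelSum step (fun e => ‖f e‖) n e ≤ 3 * K * M e := by
  have hf : ∀ e, G e → ‖f e‖ ≤ (3 * K) * W e := by
    intro e he
    have h1 : f e = g e - g (step false e) - g (step true e) := by rw [hrec e he]; ring
    have h2 := hg e he
    have h3 := hg _ (hG e false he)
    have h4 := hg _ (hG e true he)
    have h5 := mul_le_mul_of_nonneg_left (hWs e false he) hK
    have h6 := mul_le_mul_of_nonneg_left (hWs e true he) hK
    rw [h1]
    refine (norm_sub_le _ _).trans ?_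
    have := norm_sub_le (g e) (g (step false e))
    linarith
  have hlev : ∀ e, G e → ∀ n, levelSum step (fun e => ‖f e‖) n e ≤ 3 * K * M e := by
    intro e he n
    refine (levelSum_mono_of_le hG hf n he).trans ?_
    rw [levelSum_const_mul]
    exact mul_le_mul_of_nonneg_left (hWM e he n) (by positivity)
  have hsum : ∀ e, G e → Summable (fun w => ‖f (descend step w e)‖) ∧
      ∑' w, ‖f (descend step w e)‖ ≤ 3 * K * M e := fun e he =>
    summable_and_tsum_le_of_levelSum_le (fun e => norm_nonneg (f e)) (hlev e he)
  let D : S → ℂ := fun e => g e - ∑' w, f (descend step w e)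
  have hD : ∀ e, G e → D e = D (step false e) + D (step true e) := by
    intro e he
    have := (hasSum_descend (f := f) (step := step) (e := e)
      (hsum _ (hG e false he)).1.of_norm.hasSum (hsum _ (hG e true he)).1.of_norm.hasSum).tsum_eq
    simp only [D]
    rw [this, hrec e he]
    ring
  have hDW : ∀ e, G e → ‖D e‖ ≤ (K + 3 * K * K') * W e := by
    intro e he
    have h1 := norm_tsum_le_tsum_norm (hsum e he).1
    have h2 := (hsum e he).2
    have h3 := mul_le_mul_of_nonneg_left (hMW e he) (by positivity : 0 ≤ 3 * K)
    have h4 := norm_sub_le (g e) (∑' w, f (descend step w e))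
    have h5 := hg e he
    simp only [D]
    linarith
  have hDn : ∀ (n : ℕ) (e : S), G e → n * ‖D e‖ ≤ (K + 3 * K * K') * levelSum step W n e := by
    intro n
    induction n with
    | zero => intro e _; simp [levelSum]
    | succ n ih =>
      intro e he
      have h1 := ih _ (hG e false he)
      have h2 := ih _ (hG e true he)
      have h3 := hDW e he
      have h4 : ‖D e‖ ≤ ‖D (step false e)‖ + ‖D (step true e)‖ := by
        rw [hD e he]
        exact norm_add_le _ _
      have h5 := mul_le_mul_of_nonneg_left h4 (Nat.cast_nonneg (α := ℝ) n)
      simp only [levelSum]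
      push_cast
      linarith
  have hD0 : D e = 0 := by
    by_contra hne
    have hpos : 0 < ‖D e‖ := norm_pos_iff.2 hne
    obtain ⟨n, hn⟩ := exists_nat_gt (((K + 3 * K * K') * M e) / ‖D e‖)
    rw [div_lt_iff₀ hpos] at hn
    have h1 := hDn n e he
    have h2 := mul_le_mul_of_nonneg_left (hWM e he n) (by positivity : 0 ≤ K + 3 * K * K')
    linarith
  refine ⟨?_, hlev e he⟩
  have h1 : g e = ∑' w, f (descend step w e) := sub_eq_zero.1 hD0
  rw [h1]
  exact (hsum e he).1.of_norm.hasSum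

/-- Summation along a branch of the tree all of whose side branches are summed. -/
theorem hasSum_of_branch {f g : S → ℂ} {e : ℕ → S} {M : ℕ → ℝ}
    (he : ∀ n, e (n + 1) = step false (e n))
    (hrec : ∀ n, g (e n) = f (e n) + (g (e (n + 1)) + g (step true (e n))))
    (hside : ∀ n, HasSum (fun w => f (descend step w (step true (e n)))) (g (step true (e n))))
    (hM : ∀ n k, levelSum step (fun e => ‖f e‖) k (step true (e n)) ≤ M n)
    (hMs : Summable M) (hfs : Summable fun n => ‖f (e n)‖)
    (hg : Filter.Tendsto (fun n => g (e n)) Filter.atTop (nhds 0)) :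
    HasSum (fun w => f (descend step w (e 0))) (g (e 0)) := by
  set a : ℕ → ℝ := fun n => ‖f (e n)‖ + M n with ha
  have has : Summable a := hfs.add hMs
  have hM0 : ∀ n, 0 ≤ M n := fun n => by simpa [levelSum] using hM n 0
  have ha0 : ∀ n, 0 ≤ a n := fun n => add_nonneg (norm_nonneg _) (hM0 n)
  have hsplit : ∀ n, ∑' j, a (j + n) = a n + ∑' j, a (j + (n + 1)) := by
    intro n
    rw [((summable_nat_add_iff n).2 has).tsum_eq_zero_add]
    congr 1
    · simp
    · congr 1
      funext j
      congr 1
      omega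
  have hlev : ∀ k n, levelSum step (fun e => ‖f e‖) k (e n) ≤ ∑' j, a (j + n) := by
    intro k
    induction k with
    | zero => intro n; exact tsum_nonneg fun j => ha0 _
    | succ k ih =>
      intro n
      have h1 := ih (n + 1)
      have h2 := hM n k
      rw [hsplit n]
      simp only [levelSum]
      rw [← he n]
      simp only [ha] at h1 ⊢
      linarith
  have hsum : ∀ n, Summable (fun w => ‖f (descend step w (e n))‖) ∧
      ∑' w, ‖f (descend step w (e n))‖ ≤ ∑' j, a (j + n) := fun n =>
    summable_and_tsum_le_of_levelSum_le (fun e => norm_nonneg (f e)) fun k => hlev k n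
  let D : ℕ → ℂ := fun n => g (e n) - ∑' w, f (descend step w (e n))
  have hD : ∀ n, D (n + 1) = D n := by
    intro n
    have h1 := (hsum (n + 1)).1.of_norm.hasSum
    rw [he n] at h1
    have := (hasSum_descend (f := f) (step := step) (e := e n) h1 (hside n)).tsum_eq
    simp only [D]
    rw [this, hrec n, he n]
    ring
  have hD0 : ∀ n, D n = D 0 := by
    intro n
    induction n with
    | zero => rfl
    | succ n ih => rw [hD, ih]
  have ht : Filter.Tendsto D Filter.atTop (nhds 0) := by
    have h1 : Filter.Tendsto (fun n => ∑' w, f (descend step w (e n))) Filter.atTop (nhds 0) := by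
      apply squeeze_zero_norm _ (tendsto_sum_nat_add a)
      intro n
      exact (norm_tsum_le_tsum_norm (hsum n).1).trans (hsum n).2
    simpa [D] using hg.sub h1
  have hz : D 0 = 0 := by
    have h1 : D = fun _ => D 0 := funext hD0
    rw [h1] at ht
    exact tendsto_nhds_unique tendsto_const_nhds ht
  have h1 : g (e 0) = ∑' w, f (descend step w (e 0)) := sub_eq_zero.1 hz
  rw [h1]
  exact (hsum 0).1.of_norm.hasSum

end TreeSum

/-- The domain of the trace functions: the complement of the segment `[-2, 2]`. -/
def OffSegment (x : ℂ) : Prop := x ∉ Complex.ofReal '' Set.Icc (-2 : ℝ) 2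

/-- The square root in McShane's function. -/
noncomputable def mcShaneSqrt (x : ℂ) : ℂ := Complex.sqrt (1 - 4 / x ^ 2)

/-- McShane's function `(1 - √(1 - 4/x²)) / 2`. -/
noncomputable def mcShane (x : ℂ) : ℂ := (1 - mcShaneSqrt x) / 2

theorem OffSegment.ne_zero {x : ℂ} (hx : OffSegment x) : x ≠ 0 := by
  rintro rfl
  exact hx ⟨0, by norm_num, by simp⟩

theorem mcShaneSqrt_sq (x : ℂ) : mcShaneSqrt x ^ 2 = 1 - 4 / x ^ 2 := by
  unfold mcShaneSqrt Complex.sqrt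
  simp

theorem mcShane_mul (x : ℂ) : mcShane x * (1 - mcShane x) = 1 / x ^ 2 := by
  have := mcShaneSqrt_sq x
  unfold mcShane
  linear_combination (-1 / 4) * this

theorem mcShaneSqrt_re_nonneg (x : ℂ) : 0 ≤ (mcShaneSqrt x).re := by
  unfold mcShaneSqrt Complex.sqrt
  rw [Complex.cpow_inv_two_re]
  positivity

theorem mcShaneSqrt_re_pos {x : ℂ} (hx : OffSegment x) : 0 < (mcShaneSqrt x).re := by
  refine lt_of_le_of_ne (mcShaneSqrt_re_nonneg x) fun h0 => hx ?_
  have hx0 := hx.ne_zero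
  set t := (mcShaneSqrt x).im
  have h1 : mcShaneSqrt x = t * Complex.I := by
    apply Complex.ext <;> simp [t, ← h0]
  have h2 := mcShaneSqrt_sq x
  rw [h1, mul_pow, Complex.I_sq] at h2
  have h3 : x ^ 2 * (1 + (t : ℂ) ^ 2) = 4 := by
    field_simp at h2
    linear_combination -h2
  have ht : (0 : ℝ) < 1 + t ^ 2 := by positivity
  have hs : (√(1 + t ^ 2)) ^ 2 = 1 + t ^ 2 := Real.sq_sqrt ht.le
  have hs1 : 1 ≤ √(1 + t ^ 2) := Real.one_le_sqrt.2 (by nlinarith)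
  set s := √(1 + t ^ 2)
  have h4 : (x * s - 2) * (x * s + 2) = 0 := by
    have : ((s : ℂ)) ^ 2 = 1 + (t : ℂ) ^ 2 := by exact_mod_cast hs
    linear_combination h3 + x ^ 2 * this
  have hsne : (s : ℂ) ≠ 0 := by
    have : s ≠ 0 := by linarith
    exact_mod_cast this
  have hspos : 0 < s := by linarith
  have hle : 2 / s ≤ 2 := (div_le_iff₀ hspos).2 (by linarith)
  have hnn : 0 ≤ 2 / s := by positivity
  rcases mul_eq_zero.1 h4 with h | h
  · refine ⟨2 / s, ⟨by linarith, hle⟩, ?_⟩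
    push_cast
    rw [div_eq_iff hsne]
    linear_combination -h
  · refine ⟨-(2 / s), ⟨by linarith, by linarith⟩, ?_⟩
    push_cast
    rw [neg_eq_iff_eq_neg, div_eq_iff hsne]
    linear_combination h

theorem le_mcShaneSqrt_re {x : ℂ} {m : ℝ} (hm : 0 < m) (hx : 2 * m ≤ ‖x‖) :
    1 - 1 / m ^ 2 ≤ (mcShaneSqrt x).re ^ 2 := by
  have h1 := congrArg Complex.re (mcShaneSqrt_sq x)
  have h2 : (mcShaneSqrt x ^ 2).re = (mcShaneSqrt x).re ^ 2 - (mcShaneSqrt x).im ^ 2 := by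
    rw [sq, Complex.mul_re]
    ring
  have h3 : (4 / x ^ 2).re ≤ 1 / m ^ 2 := by
    refine (Complex.re_le_norm _).trans ?_
    rw [norm_div, norm_pow]
    have : (2 * m) ^ 2 ≤ ‖x‖ ^ 2 := by gcongr
    rw [div_le_div_iff₀ (by nlinarith [sq_pos_of_pos hm]) (by positivity)]
    norm_num
    nlinarith
  rw [h2, Complex.sub_re, Complex.one_re] at h1
  nlinarith [sq_nonneg (mcShaneSqrt x).im]

theorem norm_mcShane_le (x : ℂ) : ‖mcShane x‖ ≤ 2 / ‖x‖ ^ 2 := by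
  have h1 := congrArg norm (mcShane_mul x)
  rw [norm_mul, norm_div, norm_pow, norm_one] at h1
  have h2 : 1 / 2 ≤ ‖1 - mcShane x‖ := by
    refine le_trans ?_ (Complex.re_le_norm _)
    have := mcShaneSqrt_re_nonneg x
    have h3 : (1 - mcShane x).re = 1 / 2 + (mcShaneSqrt x).re / 2 := by
      simp [mcShane]
      ring
    linarith
  have h3 : ‖mcShane x‖ * (1 / 2) ≤ 1 / ‖x‖ ^ 2 := by
    rw [← h1]
    gcongr
  calc ‖mcShane x‖ ≤ 2 * (1 / ‖x‖ ^ 2) := by linarith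
    _ = _ := by ring

/-- A directed edge of the tree of Markoff triples with coloured entries: the edge separates
the regions with traces `x` and `y` and points to the region with trace `z`. -/
structure Edge where
  x : ℂ
  y : ℂ
  z : ℂ
  p : ℂ
  q : ℂ
  r : ℂ

/-- The two edges following a given one. -/
def edgeStep : Bool → Edge → Edge
  | false, e => ⟨e.x, e.z, e.x * e.z - e.y, e.p, e.r, e.q⟩
  | true, e => ⟨e.y, e.z, e.y * e.z - e.x, e.q, e.r, e.p⟩

namespace Edge

/-- The ratio `z' / (x y)` where `z' = x y - z` is the trace behind the edge. -/
noncomputable def ratio (e : Edge) : ℂ := 1 - e.z / (e.x * e.y)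

/-- The coefficient `μ / (x² - μ)`. -/
noncomputable def coeff (μ x : ℂ) : ℂ := μ / (x ^ 2 - μ)

/-- Closed form for the sum beyond an edge. -/
noncomputable def total (μ : ℂ) (e : Edge) : ℂ :=
  e.ratio - mcShane e.x - mcShane e.y + e.p * (coeff μ e.x * (e.ratio - mcShane e.x)) +
    e.q * (coeff μ e.y * (e.ratio - mcShane e.y))

/-- The summand of the region in front of an edge. -/
noncomputable def term (μ : ℂ) (e : Edge) : ℂ := 2 * h μ e.r e.z

theorem two_mul_h {μ p x : ℂ} (hx : x ^ 2 ≠ μ) :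
    2 * h μ p x = 2 * mcShane x - p * (coeff μ x * (1 - 2 * mcShane x)) := by
  have h1 : x ^ 2 - μ ≠ 0 := sub_ne_zero.2 hx
  have h2 : (x ^ 2 - (1 - p) * μ) / (x ^ 2 - μ) = 1 + p * coeff μ x := by
    unfold coeff
    field_simp
    ring
  unfold h
  rw [h2]
  unfold mcShane mcShaneSqrt
  ring

theorem total_eq {μ : ℂ} {e : Edge} (hx : e.x ≠ 0) (hy : e.y ≠ 0) (hz : e.z ≠ 0)
    (hxμ : e.x ^ 2 ≠ μ) (hyμ : e.y ^ 2 ≠ μ) (hzμ : e.z ^ 2 ≠ μ)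
    (hM : e.x ^ 2 + e.y ^ 2 + e.z ^ 2 - e.x * e.y * e.z = μ) (hc : e.p + e.q + e.r = 1) :
    e.total μ = e.term μ + ((edgeStep false e).total μ + (edgeStep true e).total μ) := by
  obtain ⟨x, y, z, p, q, r⟩ := e
  simp only at hx hy hz hxμ hyμ hzμ hM hc
  simp only [total, term, edgeStep, two_mul_h hzμ]
  have r0 : ratio ⟨x, y, z, p, q, r⟩ = 1 - z / (x * y) := rfl
  have r1 : ratio ⟨x, z, x * z - y, p, r, q⟩ = y / (x * z) := by
    simp only [ratio]
    field_simp
    ring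
  have r2 : ratio ⟨y, z, y * z - x, q, r, p⟩ = x / (y * z) := by
    simp only [ratio]
    field_simp
    ring
  have h1 : coeff μ x * (1 - z / (x * y) - y / (x * z)) = μ / (x * y * z) := by
    have h1 : x ^ 2 - μ ≠ 0 := sub_ne_zero.2 hxμ
    have : 1 - z / (x * y) - y / (x * z) = (x ^ 2 - μ) / (x * y * z) := by
      field_simp
      linear_combination -hM
    rw [this, coeff]
    field_simp
  have h2 : coeff μ y * (1 - z / (x * y) - x / (y * z)) = μ / (x * y * z) := by
    have h1 : y ^ 2 - μ ≠ 0 := sub_ne_zero.2 hyμ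
    have : 1 - z / (x * y) - x / (y * z) = (y ^ 2 - μ) / (x * y * z) := by
      field_simp
      linear_combination -hM
    rw [this, coeff]
    field_simp
  have h3 : coeff μ z * (y / (x * z) + x / (y * z) - 1) = -(μ / (x * y * z)) := by
    have h1 : z ^ 2 - μ ≠ 0 := sub_ne_zero.2 hzμ
    have : y / (x * z) + x / (y * z) - 1 = -(z ^ 2 - μ) / (x * y * z) := by
      field_simp
      linear_combination hM
    rw [this, coeff]
    field_simp
  have h4 : y / (x * z) + x / (y * z) = 1 - z / (x * y) + μ / (x * y * z) := by
    field_simp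
    linear_combination hM
  rw [r0, r1, r2]
  linear_combination p * h1 + q * h2 - r * h3 - h4 + μ / (x * y * z) * hc

theorem ratio_sub_mul {μ : ℂ} {e : Edge} (hx : e.x ≠ 0) (hy : e.y ≠ 0)
    (hM : e.x ^ 2 + e.y ^ 2 + e.z ^ 2 - e.x * e.y * e.z = μ) :
    (e.ratio - mcShane e.x) * (1 - e.ratio - mcShane e.x) =
      (e.x ^ 2 - μ) / (e.x ^ 2 * e.y ^ 2) := by
  have h1 := mcShane_mul e.x
  have h2 : e.ratio * (1 - e.ratio) = 1 / e.x ^ 2 + 1 / e.y ^ 2 - μ / (e.x ^ 2 * e.y ^ 2) := by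
    unfold ratio
    field_simp
    linear_combination -hM
  have h3 : (e.x ^ 2 - μ) / (e.x ^ 2 * e.y ^ 2) = 1 / e.y ^ 2 - μ / (e.x ^ 2 * e.y ^ 2) := by
    field_simp
  rw [h3]
  linear_combination h2 - h1

/-- Exchange of the two regions adjacent to an edge. -/
def flip (e : Edge) : Edge := ⟨e.y, e.x, e.z, e.q, e.p, e.r⟩

theorem ratio_flip (e : Edge) : e.flip.ratio = e.ratio := by
  simp [ratio, flip, mul_comm]

theorem one_half_le_re {t : ℂ} (ht : ‖1 - t‖ ≤ ‖t‖) : 1 / 2 ≤ t.re := by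
  have h1 : ‖1 - t‖ ^ 2 ≤ ‖t‖ ^ 2 := by gcongr
  rw [← Complex.normSq_eq_norm_sq, ← Complex.normSq_eq_norm_sq, Complex.normSq_apply,
    Complex.normSq_apply] at h1
  simp at h1
  nlinarith

theorem bounds_aux {μ : ℂ} {e : Edge} {δ : ℝ} (hδ : 0 < δ) (hx : 1 ≤ ‖e.x‖) (hy : e.y ≠ 0)
    (hM : e.x ^ 2 + e.y ^ 2 + e.z ^ 2 - e.x * e.y * e.z = μ)
    (hs : 2 * δ ≤ (mcShaneSqrt e.x).re) (hz : ‖e.x * e.y - e.z‖ ≤ ‖e.z‖) (hxμ : e.x ^ 2 ≠ μ) :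
    ‖e.ratio - mcShane e.x‖ ≤ (1 + ‖μ‖) / δ / ‖e.y‖ ^ 2 ∧
      ‖coeff μ e.x * (e.ratio - mcShane e.x)‖ ≤ ‖μ‖ / δ / (‖e.x‖ ^ 2 * ‖e.y‖ ^ 2) := by
  have hx0 : e.x ≠ 0 := norm_pos_iff.1 (by linarith)
  have hxy : 0 < ‖e.x * e.y‖ := norm_pos_iff.2 (mul_ne_zero hx0 hy)
  have hypos : 0 < ‖e.y‖ := norm_pos_iff.2 hy
  have h1 := ratio_sub_mul hx0 hy hM
  have ht : 1 / 2 ≤ (e.z / (e.x * e.y)).re := by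
    apply one_half_le_re
    have : 1 - e.z / (e.x * e.y) = (e.x * e.y - e.z) / (e.x * e.y) := by
      field_simp
    rw [this, norm_div, norm_div]
    gcongr
  have hd : δ ≤ ‖1 - e.ratio - mcShane e.x‖ := by
    refine le_trans ?_ (Complex.re_le_norm _)
    have h3 : (1 - e.ratio - mcShane e.x).re =
        (e.z / (e.x * e.y)).re - 1 / 2 + (mcShaneSqrt e.x).re / 2 := by
      simp [mcShane, ratio]
      ring
    linarith
  set d := 1 - e.ratio - mcShane e.x
  have hd0 : d ≠ 0 := norm_pos_iff.1 (by linarith)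
  have h2 : e.ratio - mcShane e.x = (e.x ^ 2 - μ) / (e.x ^ 2 * e.y ^ 2) / d := by
    rw [eq_div_iff hd0, h1]
  have hμ : e.x ^ 2 - μ ≠ 0 := sub_ne_zero.2 hxμ
  have h3 : coeff μ e.x * (e.ratio - mcShane e.x) = μ / (e.x ^ 2 * e.y ^ 2) / d := by
    rw [h2, coeff]
    field_simp
  constructor
  · rw [h2, norm_div, norm_div, norm_mul, norm_pow, norm_pow]
    have h4 : ‖e.x ^ 2 - μ‖ ≤ (1 + ‖μ‖) * ‖e.x‖ ^ 2 := by
      refine (norm_sub_le _ _).trans ?_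
      rw [norm_pow]
      have : 1 ≤ ‖e.x‖ ^ 2 := by nlinarith
      nlinarith [norm_nonneg μ]
    calc ‖e.x ^ 2 - μ‖ / (‖e.x‖ ^ 2 * ‖e.y‖ ^ 2) / ‖d‖
        ≤ ((1 + ‖μ‖) * ‖e.x‖ ^ 2) / (‖e.x‖ ^ 2 * ‖e.y‖ ^ 2) / δ := by gcongr
      _ = _ := by
        have : ‖e.x‖ ≠ 0 := by linarith
        field_simp
  · rw [h3, norm_div, norm_div, norm_mul, norm_pow, norm_pow]
    calc ‖μ‖ / (‖e.x‖ ^ 2 * ‖e.y‖ ^ 2) / ‖d‖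
        ≤ ‖μ‖ / (‖e.x‖ ^ 2 * ‖e.y‖ ^ 2) / δ := by gcongr
      _ = _ := by ring

theorem norm_total_le {μ : ℂ} {e : Edge} {δ P : ℝ} (hδ : 0 < δ) (hx : 1 ≤ ‖e.x‖)
    (hy : 1 ≤ ‖e.y‖) (hM : e.x ^ 2 + e.y ^ 2 + e.z ^ 2 - e.x * e.y * e.z = μ)
    (hsx : 2 * δ ≤ (mcShaneSqrt e.x).re) (hsy : 2 * δ ≤ (mcShaneSqrt e.y).re)
    (hz : ‖e.x * e.y - e.z‖ ≤ ‖e.z‖) (hxμ : e.x ^ 2 ≠ μ) (hyμ : e.y ^ 2 ≠ μ)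
    (hp : ‖e.p‖ ≤ P) (hq : ‖e.q‖ ≤ P) :
    ‖e.total μ‖ ≤ ((1 + ‖μ‖) / δ + 2 + 2 * P * (‖μ‖ / δ)) / (‖e.x‖ * ‖e.y‖) := by
  have hx0 : e.x ≠ 0 := norm_pos_iff.1 (by linarith)
  have hy0 : e.y ≠ 0 := norm_pos_iff.1 (by linarith)
  obtain ⟨a1, a2⟩ := bounds_aux hδ hx hy0 hM hsx hz hxμ
  have hflip := bounds_aux (e := e.flip) (μ := μ) hδ hy hx0
    (by simp only [flip]; linear_combination hM) hsy (by simpa [flip, mul_comm] using hz) hyμ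
  rw [ratio_flip] at hflip
  obtain ⟨b1, b2⟩ := hflip
  simp only [flip] at b1 b2
  have c1 := norm_mcShane_le e.x
  have c2 := norm_mcShane_le e.y
  set A := ‖e.x‖
  set B := ‖e.y‖
  have hA : 0 < A := by linarith
  have hB : 0 < B := by linarith
  set K := (1 + ‖μ‖) / δ + 2 with hK
  have hK0 : 0 ≤ K := by positivity
  have hAB : 1 ≤ A * B := by nlinarith
  set D := e.ratio - mcShane e.x - mcShane e.y with hD
  have d1 : ‖D‖ ≤ K / B ^ 2 := by
    refine (norm_sub_le _ _).trans ?_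
    rw [hK, add_div]
    linarith
  have d2 : ‖D‖ ≤ K / A ^ 2 := by
    have : D = e.ratio - mcShane e.y - mcShane e.x := by rw [hD]; ring
    rw [this]
    refine (norm_sub_le _ _).trans ?_
    rw [hK, add_div]
    linarith
  have d3 : ‖D‖ ≤ K / (A * B) := by
    rw [le_div_iff₀ (by positivity)] at d1 d2 ⊢
    have h1 : (‖D‖ * (A * B)) ^ 2 ≤ K ^ 2 := by
      calc (‖D‖ * (A * B)) ^ 2 = (‖D‖ * B ^ 2) * (‖D‖ * A ^ 2) := by ring
        _ ≤ K * K := by gcongr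
        _ = K ^ 2 := by ring
    exact le_of_sq_le_sq h1 hK0
  have hP : 0 ≤ P := (norm_nonneg _).trans hp
  have u1 : ‖e.p * (coeff μ e.x * (e.ratio - mcShane e.x))‖ ≤ P * (‖μ‖ / δ) / (A * B) := by
    rw [norm_mul]
    calc ‖e.p‖ * ‖coeff μ e.x * (e.ratio - mcShane e.x)‖
        ≤ P * (‖μ‖ / δ / (A ^ 2 * B ^ 2)) := by gcongr
      _ ≤ P * (‖μ‖ / δ / (A * B)) := by
        gcongr P * (‖μ‖ / δ / ?_)
        nlinarith
      _ = _ := by ring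
  have u2 : ‖e.q * (coeff μ e.y * (e.ratio - mcShane e.y))‖ ≤ P * (‖μ‖ / δ) / (A * B) := by
    rw [norm_mul]
    calc ‖e.q‖ * ‖coeff μ e.y * (e.ratio - mcShane e.y)‖
        ≤ P * (‖μ‖ / δ / (B ^ 2 * A ^ 2)) := by gcongr
      _ ≤ P * (‖μ‖ / δ / (A * B)) := by
        gcongr P * (‖μ‖ / δ / ?_)
        nlinarith
      _ = _ := by ring
  unfold total
  refine (norm_add_le _ _).trans ?_
  have := norm_add_le D (e.p * (coeff μ e.x * (e.ratio - mcShane e.x)))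
  have e1 : (K + 2 * P * (‖μ‖ / δ)) / (A * B) =
      K / (A * B) + P * (‖μ‖ / δ) / (A * B) + P * (‖μ‖ / δ) / (A * B) := by ring
  rw [e1]
  linarith

end Edge

open Filter Topology Asymptotics

namespace Edge

/-- The conditions on an edge of the tree of traces of a representation satisfying the Bowditch
conditions, for the regions adjacent to the edge and those beyond it. -/
structure Admissible (μ : ℂ) (P : ℝ) (e : Edge) : Prop where
  off_x : OffSegment e.x
  off_y : OffSegment e.y
  ne_x : e.x ^ 2 ≠ μ
  ne_y : e.y ^ 2 ≠ μ
  markoff : e.x ^ 2 + e.y ^ 2 + e.z ^ 2 - e.x * e.y * e.z = μ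
  color : e.p + e.q + e.r = 1
  norm_p : ‖e.p‖ ≤ P
  norm_q : ‖e.q‖ ≤ P
  norm_r : ‖e.r‖ ≤ P
  off_z : ∀ w, OffSegment (descend edgeStep w e).z
  ne_z : ∀ w, (descend edgeStep w e).z ^ 2 ≠ μ
  finite : {w | ‖(descend edgeStep w e).z‖ ≤ 2}.Finite

namespace Admissible

variable {μ : ℂ} {P : ℝ} {e : Edge}

theorem step (he : e.Admissible μ P) (d : Bool) : (edgeStep d e).Admissible μ P := by
  have hfin : {w | ‖(descend edgeStep w (edgeStep d e)).z‖ ≤ 2}.Finite :=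
    he.finite.preimage (f := List.cons d) (fun a _ b _ h => List.cons_injective h)
  have hM := he.markoff
  have hc := he.color
  cases d
  · exact ⟨he.off_x, he.off_z [], he.ne_x, he.ne_z [], by simp only [edgeStep]; linear_combination hM,
      by simp only [edgeStep]; linear_combination hc, he.norm_p, he.norm_r, he.norm_q,
      fun w => he.off_z (false :: w), fun w => he.ne_z (false :: w), hfin⟩
  · exact ⟨he.off_y, he.off_z [], he.ne_y, he.ne_z [], by simp only [edgeStep]; linear_combination hM,
      by simp only [edgeStep]; linear_combination hc, he.norm_q, he.norm_r, he.norm_p,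
      fun w => he.off_z (true :: w), fun w => he.ne_z (true :: w), hfin⟩

theorem total_eq (he : e.Admissible μ P) :
    e.total μ = e.term μ + ((edgeStep false e).total μ + (edgeStep true e).total μ) :=
  Edge.total_eq he.off_x.ne_zero he.off_y.ne_zero (he.off_z []).ne_zero he.ne_x he.ne_y
    (he.ne_z []) he.markoff he.color

end Admissible

/-- Edges whose adjacent regions have large traces and which point away from the minimum. -/
structure Good (μ : ℂ) (P m : ℝ) (e : Edge) : Prop extends Admissible μ P e where
  le_x : 2 * m ≤ ‖e.x‖
  le_y : 2 * m ≤ ‖e.y‖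
  le_z : ‖e.x * e.y - e.z‖ ≤ ‖e.z‖

namespace Good

variable {μ : ℂ} {P m : ℝ} {e : Edge}

theorem mul_le (he : e.Good μ P m) : ‖e.x‖ * ‖e.y‖ ≤ 2 * ‖e.z‖ := by
  have h1 := norm_add_le (e.x * e.y - e.z) e.z
  rw [sub_add_cancel, norm_mul] at h1
  have := he.le_z
  linarith

theorem le_norm_z (hm : 1 < m) (he : e.Good μ P m) : m * ‖e.x‖ ≤ ‖e.z‖ ∧ m * ‖e.y‖ ≤ ‖e.z‖ := by
  have h1 := he.mul_le
  have h2 := he.le_x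
  have h3 := he.le_y
  constructor <;> nlinarith [norm_nonneg e.x, norm_nonneg e.y]

theorem step (hm : 1 < m) (he : e.Good μ P m) (d : Bool) : (edgeStep d e).Good μ P m := by
  obtain ⟨h1, h2⟩ := he.le_norm_z hm
  have h3 := he.le_x
  have h4 := he.le_y
  have h5 : 2 * m ≤ ‖e.z‖ := by nlinarith
  have h6 : ‖e.x‖ ≤ ‖e.z‖ := by nlinarith
  have h7 : ‖e.y‖ ≤ ‖e.z‖ := by nlinarith
  cases d
  · refine ⟨he.toAdmissible.step false, h3, h5, ?_⟩
    simp only [edgeStep]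
    rw [sub_sub_cancel]
    have := norm_sub_norm_le (e.x * e.z) e.y
    rw [norm_mul] at this
    nlinarith
  · refine ⟨he.toAdmissible.step true, h4, h5, ?_⟩
    simp only [edgeStep]
    rw [sub_sub_cancel]
    have := norm_sub_norm_le (e.y * e.z) e.x
    rw [norm_mul] at this
    nlinarith

end Good

/-- The weight of an edge. -/
noncomputable def weight (e : Edge) : ℝ := 1 / (‖e.x‖ / 2 * (‖e.y‖ / 2))

/-- A bound for the sum of the weights beyond an edge. -/
noncomputable def weightBound (e : Edge) : ℝ := 1 / ((‖e.x‖ / 2 - 1) * (‖e.y‖ / 2 - 1))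

theorem weight_nonneg (e : Edge) : 0 ≤ e.weight := by
  unfold weight
  positivity

theorem weight_add_le {X Y Z : ℝ} (hX : 1 < X) (hY : 1 < Y) (hZ : X * Y ≤ Z) :
    1 / (X * Y) + (1 / ((X - 1) * (Z - 1)) + 1 / ((Y - 1) * (Z - 1))) ≤
      1 / ((X - 1) * (Y - 1)) := by
  have h1 : 1 < X * Y := by nlinarith
  have hx : 0 < X - 1 := by linarith
  have hy : 0 < Y - 1 := by linarith
  have hxy : 0 < X * Y - 1 := by linarith
  calc 1 / (X * Y) + (1 / ((X - 1) * (Z - 1)) + 1 / ((Y - 1) * (Z - 1)))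
      ≤ 1 / (X * Y) + (1 / ((X - 1) * (X * Y - 1)) + 1 / ((Y - 1) * (X * Y - 1))) := by gcongr
    _ ≤ 1 / ((X - 1) * (Y - 1)) := by
      have : 1 / ((X - 1) * (Y - 1)) -
          (1 / (X * Y) + (1 / ((X - 1) * (X * Y - 1)) + 1 / ((Y - 1) * (X * Y - 1)))) =
          1 / (X * Y * (X * Y - 1)) := by
        have := hx.ne'
        have := hy.ne'
        have := hxy.ne'
        field_simp
        ring
      have h2 : 0 ≤ 1 / (X * Y * (X * Y - 1)) := by positivity
      linarith

theorem Good.levelSum_weight_le {μ : ℂ} {P m : ℝ} {e : Edge} (hm : 1 < m) (he : e.Good μ P m)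
    (n : ℕ) : levelSum edgeStep weight n e ≤ e.weightBound := by
  induction n generalizing e with
  | zero =>
    have h1 := he.le_x
    have h2 := he.le_y
    exact one_div_nonneg.2 (mul_nonneg (by linarith) (by linarith))
  | succ n ih =>
    have h1 := ih (he.step hm false)
    have h2 := ih (he.step hm true)
    have h3 := he.le_x
    have h4 := he.le_y
    have h5 := he.mul_le
    refine le_trans ?_ (weight_add_le (X := ‖e.x‖ / 2) (Y := ‖e.y‖ / 2) (Z := ‖e.z‖ / 2)
      (by linarith) (by linarith) (by linarith))
    exact add_le_add le_rfl (add_le_add h1 h2)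

/-- The constant in the estimate of the sums beyond a good edge. -/
theorem Good.exists_norm_total_le (μ : ℂ) (P m : ℝ) (hP : 0 ≤ P) (hm : 1 < m) :
    ∃ K : ℝ, 0 ≤ K ∧ ∀ e : Edge, e.Good μ P m → ‖e.total μ‖ ≤ K * e.weight := by
  have h1 : 0 < 1 - 1 / m ^ 2 := by
    have : 1 / m ^ 2 < 1 := by
      rw [div_lt_one (by positivity)]
      nlinarith
    linarith
  set δ := √(1 - 1 / m ^ 2) / 2 with hδ
  have hδ0 : 0 < δ := by positivity
  have hs : ∀ x : ℂ, 2 * m ≤ ‖x‖ → 2 * δ ≤ (mcShaneSqrt x).re := by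
    intro x hx
    have h2 := le_mcShaneSqrt_re (by linarith) hx
    have h3 : 2 * δ = √(1 - 1 / m ^ 2) := by rw [hδ]; ring
    rw [h3]
    exact Real.sqrt_le_iff.2 ⟨mcShaneSqrt_re_nonneg x, h2⟩
  refine ⟨((1 + ‖μ‖) / δ + 2 + 2 * P * (‖μ‖ / δ)) / 4, by positivity, fun e he => ?_⟩
  have hx := he.le_x
  have hy := he.le_y
  have := norm_total_le hδ0 (by linarith) (by linarith) he.markoff (hs _ hx) (hs _ hy) he.le_z
    he.ne_x he.ne_y he.norm_p he.norm_q
  refine this.trans (le_of_eq ?_)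
  unfold weight
  have h2 : ‖e.x‖ ≠ 0 := by linarith
  have h3 : ‖e.y‖ ≠ 0 := by linarith
  field_simp
  norm_num

theorem Good.exists_hasSum (μ : ℂ) (P m : ℝ) (hP : 0 ≤ P) (hm : 1 < m) :
    ∃ K : ℝ, 0 ≤ K ∧ ∀ e : Edge, e.Good μ P m → ‖e.total μ‖ ≤ K * e.weight ∧
      HasSum (fun w => (descend edgeStep w e).term μ) (e.total μ) ∧
      ∀ n, levelSum edgeStep (fun e => ‖e.term μ‖) n e ≤ K * e.weightBound := by
  obtain ⟨K, hK, hKb⟩ := Good.exists_norm_total_le μ P m hP hm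
  have hWs : ∀ (e : Edge) d, e.Good μ P m → (edgeStep d e).weight ≤ e.weight := by
    intro e d he
    have h1 := he.le_norm_z hm
    have h2 := he.le_x
    have h3 := he.le_y
    have h4 : ‖e.x‖ ≤ ‖e.z‖ := by nlinarith
    have h5 : ‖e.y‖ ≤ ‖e.z‖ := by nlinarith
    have h6 : 0 < ‖e.x‖ := by linarith
    have h7 : 0 < ‖e.y‖ := by linarith
    cases d
    · simp only [weight, edgeStep]
      gcongr
    · simp only [weight, edgeStep]
      rw [mul_comm (‖e.x‖ / 2)]
      gcongr
  have hMW : ∀ e : Edge, e.Good μ P m → e.weightBound ≤ (m / (m - 1)) ^ 2 * e.weight := by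
    intro e he
    have h2 := he.le_x
    have h3 := he.le_y
    have h6 : 0 < ‖e.x‖ := by linarith
    have h7 : 0 < ‖e.y‖ := by linarith
    have hm1 : 0 < m - 1 := by linarith
    unfold weight weightBound
    rw [div_pow, div_mul_div_comm, mul_one, div_le_div_iff₀ (by nlinarith) (by positivity)]
    have a1 : (m - 1) * (‖e.x‖ / 2) ≤ m * (‖e.x‖ / 2 - 1) := by nlinarith
    have a2 : (m - 1) * (‖e.y‖ / 2) ≤ m * (‖e.y‖ / 2 - 1) := by nlinarith
    calc 1 * ((m - 1) ^ 2 * (‖e.x‖ / 2 * (‖e.y‖ / 2)))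
        = ((m - 1) * (‖e.x‖ / 2)) * ((m - 1) * (‖e.y‖ / 2)) := by ring
      _ ≤ (m * (‖e.x‖ / 2 - 1)) * (m * (‖e.y‖ / 2 - 1)) := by
        apply mul_le_mul a1 a2 (by positivity)
        apply mul_nonneg <;> linarith
      _ = _ := by ring
  refine ⟨3 * K, by positivity, fun e he => ⟨?_, ?_⟩⟩
  · refine (hKb e he).trans ?_
    have := e.weight_nonneg
    nlinarith
  · exact hasSum_of_levelSum_le (step := edgeStep) (f := term μ) (g := total μ) (W := weight)
      (M := weightBound) (G := Good μ P m) (fun e d he => he.step hm d)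
      (fun e he => he.toAdmissible.total_eq) hK (by positivity) hKb hWs
      (fun e he n => he.levelSum_weight_le hm n) hMW he

end Edge

theorem one_lt_norm_large_root {x : ℂ} (hx : OffSegment x) : 1 < ‖x * (1 - mcShane x)‖ := by
  have hx0 := hx.ne_zero
  have hpos := mcShaneSqrt_re_pos hx
  have h1 : ‖x * mcShane x‖ * ‖x * (1 - mcShane x)‖ = 1 := by
    rw [← norm_mul]
    have : x * mcShane x * (x * (1 - mcShane x)) = 1 := by
      have := mcShane_mul x
      field_simp at this
      linear_combination this
    rw [this, norm_one]
  have h2 : ‖mcShane x‖ < ‖1 - mcShane x‖ := by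
    apply lt_of_pow_lt_pow_left₀ 2 (norm_nonneg _)
    rw [← Complex.normSq_eq_norm_sq, ← Complex.normSq_eq_norm_sq, Complex.normSq_apply,
      Complex.normSq_apply]
    simp [mcShane]
    nlinarith
  have h3 : ‖x * mcShane x‖ < ‖x * (1 - mcShane x)‖ := by
    rw [norm_mul, norm_mul]
    exact mul_lt_mul_of_pos_left h2 (norm_pos_iff.2 hx0)
  have h4 := norm_nonneg (x * mcShane x)
  nlinarith

namespace Edge

variable {μ : ℂ} {P : ℝ}

/-- The sequence of edges around the region of trace `e.x`. -/
def spiral (e : Edge) (n : ℕ) : Edge := (edgeStep false)^[n] e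

theorem spiral_succ (e : Edge) (n : ℕ) : e.spiral (n + 1) = edgeStep false (e.spiral n) :=
  Function.iterate_succ_apply' _ _ _

theorem spiral_x (e : Edge) (n : ℕ) : (e.spiral n).x = e.x := by
  induction n with
  | zero => rfl
  | succ n ih => rw [spiral_succ]; exact ih

theorem spiral_p (e : Edge) (n : ℕ) : (e.spiral n).p = e.p := by
  induction n with
  | zero => rfl
  | succ n ih => rw [spiral_succ]; exact ih

theorem spiral_y_succ (e : Edge) (n : ℕ) : (e.spiral (n + 1)).y = (e.spiral n).z := by
  rw [spiral_succ]; rfl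

theorem spiral_z_succ (e : Edge) (n : ℕ) :
    (e.spiral (n + 1)).z = e.x * (e.spiral n).z - (e.spiral n).y := by
  rw [spiral_succ]
  simp only [edgeStep, spiral_x]

theorem spiral_large (e : Edge) (hx : OffSegment e.x) (n : ℕ) :
    (e.spiral n).z - e.x * mcShane e.x * (e.spiral n).y =
      (e.x * (1 - mcShane e.x)) ^ n * (e.z - e.x * mcShane e.x * e.y) := by
  induction n with
  | zero => simp [spiral]
  | succ n ih =>
    rw [spiral_y_succ, spiral_z_succ, pow_succ', mul_assoc (e.x * (1 - mcShane e.x)), ← ih]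
    have := mcShane_mul e.x
    have hx0 := hx.ne_zero
    field_simp at this
    linear_combination (e.spiral n).y * this

theorem spiral_small (e : Edge) (hx : OffSegment e.x) (n : ℕ) :
    (e.spiral n).z - e.x * (1 - mcShane e.x) * (e.spiral n).y =
      (e.x * mcShane e.x) ^ n * (e.z - e.x * (1 - mcShane e.x) * e.y) := by
  induction n with
  | zero => simp [spiral]
  | succ n ih =>
    rw [spiral_y_succ, spiral_z_succ, pow_succ', mul_assoc (e.x * mcShane e.x), ← ih]
    have := mcShane_mul e.x
    have hx0 := hx.ne_zero
    field_simp at this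
    linear_combination (e.spiral n).y * this

theorem large_mul_small (e : Edge) (hx : OffSegment e.x) :
    (e.z - e.x * mcShane e.x * e.y) * (e.z - e.x * (1 - mcShane e.x) * e.y) =
      (e.x ^ 2 + e.y ^ 2 + e.z ^ 2 - e.x * e.y * e.z) - e.x ^ 2 := by
  have := mcShane_mul e.x
  have hx0 := hx.ne_zero
  field_simp at this
  linear_combination e.y ^ 2 * this

theorem Admissible.spiral {e : Edge} (he : e.Admissible μ P) (n : ℕ) :
    (e.spiral n).Admissible μ P := by
  induction n with
  | zero => exact he
  | succ n ih => rw [spiral_succ]; exact ih.step false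

/-- The traces around a region grow exponentially. -/
theorem Admissible.isBigO_spiral {e : Edge} (he : e.Admissible μ P) :
    (fun n => ((e.spiral n).y)⁻¹) =O[atTop]
      (fun n : ℕ => (‖e.x * (1 - mcShane e.x)‖⁻¹) ^ n) := by
  have hΛ := one_lt_norm_large_root he.off_x
  set l := e.x * (1 - mcShane e.x) with hl
  set l' := e.x * mcShane e.x with hl'
  set a := e.z - l' * e.y with ha
  set b := e.z - l * e.y with hb
  have hab : a * b ≠ 0 := by
    rw [ha, hb, hl, hl', large_mul_small e he.off_x, he.markoff]
    exact sub_ne_zero.2 he.ne_x.symm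
  have ha0 : 0 < ‖a‖ := norm_pos_iff.2 (left_ne_zero_of_mul hab)
  have hll : l * l' = 1 := by
    have := mcShane_mul e.x
    have hx0 := he.off_x.ne_zero
    field_simp at this
    rw [hl, hl']
    linear_combination this
  have hl'1 : ‖l'‖ ≤ 1 := by
    have h1 := congrArg norm hll
    rw [norm_mul, norm_one] at h1
    have := norm_nonneg l'
    nlinarith
  have hev : ∀ᶠ n : ℕ in atTop, 2 * ‖b‖ / ‖a‖ ≤ ‖l‖ ^ n :=
    (tendsto_pow_atTop_atTop_of_one_lt hΛ).eventually_ge_atTop _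
  refine IsBigO.of_bound (2 * (‖l‖ + ‖l'‖) / ‖a‖) ?_
  filter_upwards [hev] with n hn
  have e1 := spiral_large e he.off_x n
  have e2 := spiral_small e he.off_x n
  rw [← hl, ← hl'] at e1 e2
  rw [← ha] at e1
  rw [← hb] at e2
  have e3 : (l - l') * (e.spiral n).y = l ^ n * a - l' ^ n * b := by
    linear_combination e1 - e2
  have e4 : ‖l‖ ^ n * ‖a‖ ≤ (‖l‖ + ‖l'‖) * ‖(e.spiral n).y‖ + ‖b‖ := by
    have h1 : l ^ n * a = (l - l') * (e.spiral n).y + l' ^ n * b := by rw [e3]; ring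
    have h2 := congrArg norm h1
    rw [norm_mul, norm_pow] at h2
    rw [h2]
    refine (norm_add_le _ _).trans ?_
    rw [norm_mul, norm_mul, norm_pow]
    have h3 := norm_sub_le l l'
    have h4 : ‖l'‖ ^ n ≤ 1 := pow_le_one₀ (norm_nonneg _) hl'1
    have h5 := mul_le_mul_of_nonneg_right h3 (norm_nonneg (e.spiral n).y)
    have h6 := mul_le_mul_of_nonneg_right h4 (norm_nonneg b)
    linarith
  rw [div_le_iff₀ ha0] at hn
  have hy0 : 0 < ‖(e.spiral n).y‖ := norm_pos_iff.2 (he.spiral n).off_y.ne_zero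
  have hlp : 0 < ‖l‖ ^ n := by positivity
  rw [norm_inv, norm_pow, norm_inv, norm_norm, inv_pow, ← one_div, ← one_div, div_mul_div_comm,
    div_le_div_iff₀ hy0 (by positivity)]
  nlinarith

theorem Admissible.exists_hasSum_spiral (hP : 0 ≤ P) {e : Edge} (he : e.Admissible μ P) :
    ∃ n, HasSum (fun w => (descend edgeStep w (e.spiral n)).term μ) ((e.spiral n).total μ) := by
  obtain ⟨K, hK, hKb⟩ := Good.exists_hasSum μ P 2 hP (by norm_num)
  have hΛ := one_lt_norm_large_root he.off_x
  have hO := he.isBigO_spiral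
  set l := e.x * (1 - mcShane e.x) with hl
  set ρ := ‖l‖⁻¹ with hρ
  have hρ0 : 0 ≤ ρ := by positivity
  have hρ1 : ρ < 1 := inv_lt_one_of_one_lt₀ hΛ
  have hρs : Summable (fun n : ℕ => ρ ^ n) := summable_geometric_of_lt_one hρ0 hρ1
  have hρt : Tendsto (fun n : ℕ => ρ ^ n) atTop (𝓝 0) := tendsto_pow_atTop_nhds_zero_of_lt_one hρ0 hρ1
  have hy0 : ∀ n, (e.spiral n).y ≠ 0 := fun n => (he.spiral n).off_y.ne_zero
  have hinv : Tendsto (fun n => ((e.spiral n).y)⁻¹) atTop (𝓝 0) := hO.trans_tendsto hρt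
  have hinvn : Tendsto (fun n => ‖((e.spiral n).y)⁻¹‖) atTop (𝓝 0) := by
    simpa using hinv.norm
  have hbig : ∀ C : ℝ, ∀ᶠ n in atTop, C ≤ ‖(e.spiral n).y‖ := by
    intro C
    have hC : 0 < (max C 1)⁻¹ := by positivity
    filter_upwards [hinvn.eventually_lt_const hC] with n hn
    rw [norm_inv] at hn
    have := (inv_lt_inv₀ (norm_pos_iff.2 (hy0 n)) (by positivity)).1 hn
    exact (le_max_left _ _).trans this.le
  have hbig' : ∀ C : ℝ, ∀ᶠ n in atTop, C ≤ ‖(e.spiral n).z‖ := by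
    intro C
    filter_upwards [(tendsto_add_atTop_nat 1).eventually (hbig C)] with n hn
    rwa [spiral_y_succ] at hn
  have hgood : ∀ᶠ n in atTop, (edgeStep true (e.spiral n)).Good μ P 2 := by
    filter_upwards [hbig 4, hbig' 4, hbig (2 * ‖e.x‖)] with n h1 h2 h3
    refine ⟨(he.spiral n).step true, by simpa [edgeStep] using (by linarith),
      by simpa [edgeStep] using (by linarith), ?_⟩
    simp only [edgeStep]
    rw [sub_sub_cancel, spiral_x]
    have := norm_sub_norm_le ((e.spiral n).y * (e.spiral n).z) e.x
    rw [norm_mul] at this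
    nlinarith [norm_nonneg e.x]
  have hside : ∀ᶠ n in atTop, (edgeStep true (e.spiral n)).weightBound ≤
        4 * ‖((e.spiral n).y)⁻¹‖ ∧
      (edgeStep true (e.spiral n)).weight ≤ 4 * ‖((e.spiral n).y)⁻¹‖ := by
    filter_upwards [hbig 4, hbig' 4] with n h1 h2
    have h3 : 0 < ‖(e.spiral n).y‖ := by linarith
    rw [norm_inv, ← one_div, mul_one_div]
    constructor
    · simp only [edgeStep, weightBound]
      rw [div_le_div_iff₀ (by nlinarith) h3]
      nlinarith
    · simp only [edgeStep, weight]
      rw [div_le_div_iff₀ (by positivity) h3]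
      nlinarith
  set a := e.z - e.x * mcShane e.x * e.y with ha
  have ha0 : a ≠ 0 := by
    have := large_mul_small e he.off_x
    rw [he.markoff] at this
    exact left_ne_zero_of_mul (this ▸ sub_ne_zero.2 he.ne_x.symm)
  have hr : ∀ n, (e.spiral n).ratio - mcShane e.x =
      (e.x ^ 2 - μ) / (e.x * a) * (((e.spiral n).y)⁻¹ * (l ^ n)⁻¹) := by
    intro n
    have h1 := ratio_sub_mul (μ := μ) (e := e.spiral n) (he.spiral n).off_x.ne_zero (hy0 n)
      (he.spiral n).markoff
    have h2 := spiral_large e he.off_x n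
    rw [spiral_x] at h1
    have hx0 := he.off_x.ne_zero
    have hyn := hy0 n
    have hl0 : l ≠ 0 := norm_pos_iff.1 (by linarith)
    have h3 : 1 - (e.spiral n).ratio - mcShane e.x = l ^ n * a / (e.x * (e.spiral n).y) := by
      rw [← h2, ratio, spiral_x]
      field_simp
      ring
    rw [h3] at h1
    field_simp at h1 ⊢
    linear_combination h1
  have hrO : (fun n => (e.spiral n).ratio - mcShane e.x) =O[atTop] (fun n : ℕ => ρ ^ n) := by
    have h1 : (fun n : ℕ => (l ^ n)⁻¹) =O[atTop] (fun _ => (1 : ℝ)) := by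
      refine IsBigO.of_bound 1 (Eventually.of_forall fun n => ?_)
      rw [norm_inv, norm_pow, norm_one, mul_one]
      exact inv_le_one_of_one_le₀ (one_le_pow₀ hΛ.le)
    have h2 := (hO.mul h1).const_mul_left ((e.x ^ 2 - μ) / (e.x * a))
    simp only [mul_one] at h2
    exact h2.congr_left fun n => (hr n).symm
  have hmO : (fun n => mcShane (e.spiral n).y) =O[atTop] (fun n : ℕ => ρ ^ n) := by
    refine IsBigO.trans ?_ hO
    refine IsBigO.of_bound 2 ?_
    filter_upwards [hbig 1] with n hn
    refine (norm_mcShane_le _).trans ?_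
    rw [norm_inv, ← one_div, mul_one_div]
    gcongr
    nlinarith
  have hcO : (fun n => coeff μ (e.spiral n).y) =O[atTop] (fun n : ℕ => ρ ^ n) := by
    refine IsBigO.trans ?_ hO
    refine IsBigO.of_bound (2 * ‖μ‖) ?_
    filter_upwards [hbig 1, hbig (2 * ‖μ‖)] with n h1 h2
    have h3 : ‖(e.spiral n).y‖ / 2 ≤ ‖(e.spiral n).y ^ 2 - μ‖ := by
      have := norm_sub_norm_le ((e.spiral n).y ^ 2) μ
      rw [norm_pow] at this
      nlinarith
    rw [coeff, norm_div, norm_inv, ← one_div, mul_one_div]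
    calc ‖μ‖ / ‖(e.spiral n).y ^ 2 - μ‖ ≤ ‖μ‖ / (‖(e.spiral n).y‖ / 2) := by gcongr
      _ = _ := by ring
  have hcrO : (fun n => coeff μ (e.spiral n).y * ((e.spiral n).ratio - mcShane (e.spiral n).y))
      =O[atTop] (fun n : ℕ => ρ ^ n) := by
    have h1 : Tendsto (fun n => (e.spiral n).ratio - mcShane (e.spiral n).y) atTop
        (𝓝 (0 + mcShane e.x - 0)) := by
      have := ((hrO.trans_tendsto hρt).add_const (mcShane e.x)).sub (hmO.trans_tendsto hρt)
      refine this.congr fun n => ?_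
      ring
    have := hcO.mul (h1.isBigO_one ℝ)
    simpa using this
  have htO : (fun n => (e.spiral n).total μ) =O[atTop] (fun n : ℕ => ρ ^ n) := by
    have hq : (fun n => (e.spiral n).q) =O[atTop] (fun _ => (1 : ℝ)) :=
      IsBigO.of_bound P (Eventually.of_forall fun n => by simpa using (he.spiral n).norm_q)
    have h1 := (hq.mul hcrO)
    simp only [one_mul] at h1
    have h2 := ((hrO.sub hmO).add (hrO.const_mul_left (e.p * coeff μ e.x))).add h1
    refine h2.congr_left fun n => ?_
    simp only [total, spiral_x, spiral_p]
    ring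
  have hsO : (fun n => (edgeStep true (e.spiral n)).total μ) =O[atTop] (fun n : ℕ => ρ ^ n) := by
    refine IsBigO.trans ?_ hO
    refine IsBigO.of_bound (K * 4) ?_
    filter_upwards [hgood, hside] with n h1 h2
    refine (hKb _ h1).1.trans ?_
    rw [mul_assoc]
    gcongr
    exact h2.2
  have hfO : (fun n => (e.spiral n).term μ) =O[atTop] (fun n : ℕ => ρ ^ n) := by
    have h1 : (fun n => (e.spiral (n + 1)).total μ) =O[atTop] (fun n : ℕ => ρ ^ n) := by
      have h2 := htO.comp_tendsto (tendsto_add_atTop_nat 1)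
      refine IsBigO.trans h2 (IsBigO.of_bound 1 (Eventually.of_forall fun n => ?_))
      simp only [Function.comp, one_mul, norm_pow, Real.norm_eq_abs, abs_of_nonneg hρ0]
      exact pow_le_pow_of_le_one hρ0 hρ1.le (Nat.le_succ n)
    refine ((htO.sub h1).sub hsO).congr_left fun n => ?_
    have := (he.spiral n).total_eq
    rw [spiral_succ]
    linear_combination this
  have hMO : (fun n => K * (edgeStep true (e.spiral n)).weightBound) =O[atTop]
      (fun n : ℕ => ρ ^ n) := by
    refine IsBigO.trans ?_ hO
    refine IsBigO.of_bound (K * 4) ?_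
    filter_upwards [hgood, hside] with n h1 h2
    have h3 : 0 ≤ (edgeStep true (e.spiral n)).weightBound := by
      have := h1.levelSum_weight_le (by norm_num) 0
      simpa [levelSum] using this
    rw [Real.norm_eq_abs, abs_of_nonneg (by positivity), mul_assoc]
    gcongr
    exact h2.1
  obtain ⟨N, hN⟩ := eventually_atTop.1 hgood
  refine ⟨N, ?_⟩
  have hshift : ∀ n, e.spiral (n + 1 + N) = edgeStep false (e.spiral (n + N)) := by
    intro n
    rw [← spiral_succ]
    congr 1
    omega
  have := hasSum_of_branch (step := edgeStep) (f := term μ) (g := total μ)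
    (e := fun n => e.spiral (n + N)) (M := fun n => K * (edgeStep true (e.spiral (n + N))).weightBound)
    hshift (fun n => by rw [hshift]; exact (he.spiral _).total_eq)
    (fun n => (hKb _ (hN _ (by omega))).2.1) (fun n k => (hKb _ (hN _ (by omega))).2.2 k)
    ((summable_nat_add_iff N).2 (summable_of_isBigO_nat hρs hMO))
    ((summable_nat_add_iff (f := fun n => ‖(e.spiral n).term μ‖) N).2
      (summable_of_isBigO_nat hρs hfO.norm_left))
    ((tendsto_add_atTop_iff_nat (f := fun n => (e.spiral n).total μ) N).2
      (htO.trans_tendsto hρt))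
  simpa using this

end Edge

theorem norm_sub_sq_eq (a b : ℂ) : ‖a - b‖ ^ 2 = 2 * ‖a‖ ^ 2 + 2 * ‖b‖ ^ 2 - ‖a + b‖ ^ 2 := by
  simp only [← Complex.normSq_eq_norm_sq, Complex.normSq_apply]
  simp
  ring

/-- Two consecutive steps of a descent which hardly decrease the traces force `μ` close
to `4`. -/
theorem norm_sub_four_le {μ p a a' c c' : ℂ} {M η s : ℝ} (h1 : p * a = c + c')
    (h2 : p * c' = a + a') (hc : ‖c'‖ ≤ ‖c‖) (ha : ‖a'‖ ≤ ‖a‖) (hcη : ‖c‖ - ‖c'‖ ≤ η)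
    (hp : 2 ≤ ‖p‖) (hc' : 2 ≤ ‖c'‖)
    (hpM : ‖p‖ ≤ M) (haM : ‖a‖ ≤ M) (hcM : ‖c‖ ≤ M) (hη : η ≤ 2 * ‖a‖)
    (hμ : p ^ 2 + a ^ 2 + c' ^ 2 - p * a * c' = μ) (hs : 0 ≤ s) (hsη : 4 * M * η ≤ s ^ 2) :
    ‖μ - 4‖ ≤ (M ^ 2 + 4) * (s / 4 + M * s / 8) + s ^ 2 / 4 := by
  have hη0 : 0 ≤ η := by linarith
  have hM0 : 0 ≤ M := (norm_nonneg _).trans hpM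
  have hpa : 2 * ‖a‖ ≤ ‖c + c'‖ := by
    rw [← h1, norm_mul]
    nlinarith [norm_nonneg a]
  have hpc : 2 * ‖c'‖ ≤ ‖a + a'‖ := by
    rw [← h2, norm_mul]
    nlinarith [norm_nonneg c']
  have hac : ‖c'‖ ≤ ‖a‖ := by
    have := norm_add_le a a'
    linarith
  have hu : ‖c - c'‖ ≤ s := by
    apply le_of_sq_le_sq _ hs
    have h3 : (2 * ‖c'‖) ^ 2 ≤ ‖c + c'‖ ^ 2 := by
      apply pow_le_pow_left₀ (by positivity)
      linarith
    have h4 := norm_sub_sq_eq c c'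
    have h5 : (‖c‖ - ‖c'‖) * (‖c‖ + ‖c'‖) ≤ η * (2 * M) := by
      apply mul_le_mul hcη (by linarith) (by positivity) hη0
    nlinarith
  have hv : ‖a - a'‖ ≤ s := by
    apply le_of_sq_le_sq _ hs
    have h3 : 2 * ‖a‖ - η ≤ ‖a + a'‖ := by
      have := norm_add_le c c'
      linarith
    have h4 : (2 * ‖a‖ - η) ^ 2 ≤ ‖a + a'‖ ^ 2 := pow_le_pow_left₀ (by linarith) h3 2
    have h5 := norm_sub_sq_eq a a'
    have h6 : ‖a'‖ ^ 2 ≤ ‖a‖ ^ 2 := by gcongr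
    have h7 : η * ‖a‖ ≤ η * M := by gcongr
    nlinarith [sq_nonneg η]
  have hd : ‖1 - p ^ 2 / 4‖ ≤ s / 4 + M * s / 8 := by
    have h3 : c' * (1 - p ^ 2 / 4) = (c' - c) / 2 + p / 4 * (a - a') := by
      linear_combination -(1 / 2) * h1 - p / 4 * h2
    have h4 : 2 * ‖1 - p ^ 2 / 4‖ ≤ ‖c' * (1 - p ^ 2 / 4)‖ := by
      rw [norm_mul]
      gcongr
    rw [h3] at h4
    have h5 := norm_add_le ((c' - c) / 2) (p / 4 * (a - a'))
    rw [norm_div, norm_sub_rev c' c, norm_mul, norm_div] at h5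
    norm_num at h5
    have h6 : ‖p‖ / 4 * ‖a - a'‖ ≤ M / 4 * s := by gcongr
    linarith
  have h3 : μ - 4 = (a ^ 2 - 4) * (1 - p ^ 2 / 4) + (c - c') ^ 2 / 4 := by
    rw [← hμ]
    have : c = p * a - c' := by linear_combination -h1
    rw [this]
    ring
  rw [h3]
  refine (norm_add_le _ _).trans ?_
  rw [norm_mul, norm_div, norm_pow]
  have h4 : ‖a ^ 2 - 4‖ ≤ M ^ 2 + 4 := by
    refine (norm_sub_le _ _).trans ?_
    rw [norm_pow]
    norm_num
    gcongr
  norm_num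
  gcongr

namespace Edge

variable {μ : ℂ} {P : ℝ}

/-- There is no infinite descent among traces of modulus greater than two. -/
theorem not_descending (hμ : μ ≠ 4) (e : ℕ → Edge) (d : ℕ → Bool)
    (he : ∀ n, e (n + 1) = edgeStep (d n) (e n))
    (hM : ∀ n, (e n).x ^ 2 + (e n).y ^ 2 + (e n).z ^ 2 - (e n).x * (e n).y * (e n).z = μ)
    (hx : ∀ n, 2 ≤ ‖(e n).x‖) (hy : ∀ n, 2 ≤ ‖(e n).y‖) (hz : ∀ n, 2 ≤ ‖(e n).z‖)
    (hd : ∀ n, ‖(e n).z‖ ≤ ‖(e n).x * (e n).y - (e n).z‖) : False := by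
  set w : ℕ → ℂ := fun n => (e n).x * (e n).y - (e n).z with hw
  set S : ℕ → ℝ := fun n => ‖(e n).x‖ + ‖(e n).y‖ + ‖(e n).z‖ with hS
  have hsplit : ∀ n, ((e (n + 1)).x = (e n).x ∧ w (n + 1) = (e n).y) ∨
      ((e (n + 1)).x = (e n).y ∧ w (n + 1) = (e n).x) := by
    intro n
    simp only [hw]
    rw [he n]
    cases d n
    · left
      simp [edgeStep]
    · right
      simp [edgeStep]
  have hyz : ∀ n, (e (n + 1)).y = (e n).z := by
    intro n
    rw [he n]
    cases d n <;> rfl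
  have hnorm : ∀ n, ‖(e (n + 1)).x‖ + ‖w (n + 1)‖ = ‖(e n).x‖ + ‖(e n).y‖ := by
    intro n
    rcases hsplit n with ⟨h1, h2⟩ | ⟨h1, h2⟩ <;> rw [h1, h2]
    ring
  have hgap : ∀ n, ‖w (n + 1)‖ - ‖(e (n + 1)).z‖ = S n - S (n + 1) := by
    intro n
    have := hnorm n
    simp only [hS, hyz]
    linarith
  have hanti : Antitone S := antitone_nat_of_succ_le fun n => by
    have h1 := hgap n
    have h2 := hd (n + 1)
    simp only [hw] at h1
    linarith
  have hbdd : BddBelow (Set.range S) := ⟨0, by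
    rintro _ ⟨n, rfl⟩
    simp only [hS]
    positivity⟩
  have hlim := tendsto_atTop_ciInf hanti hbdd
  set ℓ := ⨅ n, S n
  have hlim1 := (tendsto_add_atTop_iff_nat 1).2 hlim
  have hlim2 := (tendsto_add_atTop_iff_nat 2).2 hlim
  have hη : Tendsto (fun n => S n - S (n + 1)) atTop (𝓝 0) := by
    simpa using hlim.sub hlim1
  set M := S 0 with hMdef
  have hM0 : 0 ≤ M := by
    simp only [hMdef, hS]
    positivity
  have hSM : ∀ n, S n ≤ M := fun n => hanti (Nat.zero_le n)
  have hwM : ∀ n, ‖w (n + 1)‖ ≤ M := by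
    intro n
    have h1 := hnorm n
    have h2 := hSM n
    simp only [hS] at h2
    linarith [norm_nonneg (e (n + 1)).x, norm_nonneg (e n).z]
  have hxM : ∀ n, ‖(e n).x‖ ≤ M := by
    intro n
    have h2 := hSM n
    simp only [hS] at h2
    linarith [norm_nonneg (e n).y, norm_nonneg (e n).z]
  have hst : Tendsto (fun n => √(4 * M * (S n - S (n + 1)))) atTop (𝓝 0) := by
    have := (hη.const_mul (4 * M)).sqrt
    simpa using this
  have hbound : ∀ᶠ n in atTop, ‖μ - 4‖ ≤ (M ^ 2 + 4) * (√(4 * M * (S n - S (n + 1))) / 4 +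
      M * √(4 * M * (S n - S (n + 1))) / 8) + √(4 * M * (S n - S (n + 1))) ^ 2 / 4 := by
    filter_upwards [hη.eventually_lt_const (by norm_num : (0 : ℝ) < 4)] with n hn
    have hgn : 0 ≤ S n - S (n + 1) := sub_nonneg.2 (hanti (Nat.le_succ n))
    have hprod : (e (n + 2)).x * w (n + 2) = (e (n + 1)).x * (e (n + 1)).y := by
      rcases hsplit (n + 1) with ⟨h1, h2⟩ | ⟨h1, h2⟩ <;> rw [h1, h2]
      ring
    have hw2 : 2 ≤ ‖w (n + 2)‖ := by
      rcases hsplit (n + 1) with ⟨h1, h2⟩ | ⟨h1, h2⟩ <;> rw [h2]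
      · exact hy _
      · exact hx _
    apply norm_sub_four_le (p := (e (n + 2)).x) (a := w (n + 2)) (a' := (e (n + 2)).z)
      (c := w (n + 1)) (c' := (e (n + 1)).z) (η := S n - S (n + 1))
    · rw [hprod]
      simp only [hw]
      ring
    · rw [← hyz (n + 1)]
      simp only [hw]
      ring
    · exact hd (n + 1)
    · exact hd (n + 2)
    · exact (hgap n).le
    · exact hx _
    · exact hz _
    · exact hxM _
    · exact hwM _
    · exact hwM _
    · linarith
    · rw [← hM (n + 1), mul_assoc, mul_assoc]
      rcases hsplit (n + 1) with ⟨h1, h2⟩ | ⟨h1, h2⟩ <;> rw [h1, h2]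
      ring
    · positivity
    · rw [Real.sq_sqrt (by positivity)]
  have hfin : Tendsto (fun n => (M ^ 2 + 4) * (√(4 * M * (S n - S (n + 1))) / 4 +
      M * √(4 * M * (S n - S (n + 1))) / 8) + √(4 * M * (S n - S (n + 1))) ^ 2 / 4)
      atTop (𝓝 0) := by
    have := (((hst.div_const 4).add ((hst.const_mul M).div_const 8)).const_mul (M ^ 2 + 4)).add
      ((hst.pow 2).div_const 4)
    simpa using this
  have := ge_of_tendsto hfin hbound
  exact hμ (sub_eq_zero.1 (norm_le_zero_iff.1 this))

/-- The sum of the terms beyond an edge. -/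
theorem Admissible.hasSum (hμ : μ ≠ 4) (hP : 0 ≤ P) {e : Edge} (he : e.Admissible μ P) :
    HasSum (fun w => (descend edgeStep w e).term μ) (e.total μ) := by
  classical
  by_contra hcon
  let Q : Edge → Prop := fun e => HasSum (fun w => (descend edgeStep w e).term μ) (e.total μ)
  let dir : Edge → Bool := fun e => decide (Q (edgeStep false e))
  have hdir : ∀ e : Edge, e.Admissible μ P → ¬ Q e → ¬ Q (edgeStep (dir e) e) := by
    intro e he hQ hQd
    by_cases hf : Q (edgeStep false e)
    · have hd : dir e = true := by simp [dir, hf]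
      rw [hd] at hQd
      apply hQ
      simp only [Q]
      rw [he.total_eq]
      exact hasSum_descend (f := term μ) hf hQd
    · have hd : dir e = false := by simp [dir, hf]
      rw [hd] at hQd
      exact hf hQd
  let E : ℕ → Edge := fun n => (fun e => edgeStep (dir e) e)^[n] e
  have hE : ∀ n, E (n + 1) = edgeStep (dir (E n)) (E n) := fun n =>
    Function.iterate_succ_apply' _ _ _
  have hEQ : ∀ n, (E n).Admissible μ P ∧ ¬ Q (E n) := by
    intro n
    induction n with
    | zero => exact ⟨he, hcon⟩
    | succ n ih =>
      rw [hE]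
      exact ⟨ih.1.step _, hdir _ ih.1 ih.2⟩
  have hW : ∀ n, ∃ w : List Bool, w.length = n ∧ E n = descend edgeStep w e := by
    intro n
    induction n with
    | zero => exact ⟨[], rfl, rfl⟩
    | succ n ih =>
      obtain ⟨w, hw, hwE⟩ := ih
      exact ⟨w ++ [dir (E n)], by simp [hw], by rw [hE, descend_concat, ← hwE]⟩
  choose W hWl hWE using hW
  have hWinj : Function.Injective W := fun m n h => by rw [← hWl m, ← hWl n, h]
  have hfin : {n | ‖(E n).z‖ ≤ 2}.Finite := by
    refine (he.finite.preimage hWinj.injOn).subset fun n hn => ?_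
    change ‖(descend edgeStep (W n) e).z‖ ≤ 2
    rw [← hWE]
    exact hn
  obtain ⟨N, hN⟩ := hfin.bddAbove
  have hz : ∀ n, N < n → 2 < ‖(E n).z‖ := by
    intro n hn
    by_contra! hle
    exact absurd (hN hle) (by omega)
  have hyz : ∀ n, (E (n + 1)).y = (E n).z := by
    intro n
    rw [hE]
    cases dir (E n) <;> rfl
  have hy : ∀ n, N + 1 < n → 2 < ‖(E n).y‖ := by
    intro n hn
    obtain ⟨k, rfl⟩ := Nat.exists_eq_add_of_lt hn
    rw [hyz]
    exact hz _ (by omega)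
  have hxs : ∀ n, (E (n + 1)).x = (E n).x ∧ dir (E n) = false ∨ (E (n + 1)).x = (E n).y := by
    intro n
    rw [hE]
    cases dir (E n)
    · exact Or.inl ⟨rfl, rfl⟩
    · exact Or.inr rfl
  by_cases hlarge : ∃ n, N + 1 < n ∧ 2 < ‖(E n).x‖
  · obtain ⟨n₀, hn₀, hx₀⟩ := hlarge
    have hx : ∀ k, 2 < ‖(E (k + n₀)).x‖ := by
      intro k
      induction k with
      | zero => simpa using hx₀
      | succ k ih =>
        rw [show k + 1 + n₀ = (k + n₀) + 1 by omega]
        rcases hxs (k + n₀) with ⟨h, _⟩ | h <;> rw [h]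
        · exact ih
        · exact hy _ (by omega)
    refine not_descending hμ (fun k => E (k + n₀)) (fun k => dir (E (k + n₀)))
      (fun k => ?_) (fun k => (hEQ _).1.markoff) (fun k => (hx k).le)
      (fun k => (hy _ (by omega)).le) (fun k => (hz _ (by omega)).le) (fun k => ?_)
    · rw [show k + 1 + n₀ = (k + n₀) + 1 by omega]
      exact hE _
    · by_contra! hlt
      have h1 := hx k
      have h2 := hy (k + n₀) (by omega)
      obtain ⟨K, -, hK⟩ := Good.exists_hasSum μ P
        (min ‖(E (k + n₀)).x‖ ‖(E (k + n₀)).y‖ / 2) hP (by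
          have := lt_min h1 h2
          linarith)
      refine (hEQ (k + n₀)).2 (hK _ ⟨(hEQ (k + n₀)).1, ?_, ?_, hlt.le⟩).2.1
      · have := min_le_left ‖(E (k + n₀)).x‖ ‖(E (k + n₀)).y‖
        linarith
      · have := min_le_right ‖(E (k + n₀)).x‖ ‖(E (k + n₀)).y‖
        linarith
  · push Not at hlarge
    have hspiral : ∀ k, E (k + (N + 2)) = (E (N + 2)).spiral k := by
      intro k
      induction k with
      | zero =>
        rw [zero_add]
        rfl
      | succ k ih =>
        rw [show k + 1 + (N + 2) = (k + (N + 2)) + 1 by omega, spiral_succ, ← ih, hE]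
        rcases hxs (k + (N + 2)) with ⟨_, h⟩ | h
        · rw [h]
        · have h1 := hlarge (k + (N + 2) + 1) (by omega)
          have h2 := hy (k + (N + 2)) (by omega)
          rw [h] at h1
          linarith
    obtain ⟨n, hn⟩ := (hEQ (N + 2)).1.exists_hasSum_spiral hP
    rw [← hspiral] at hn
    exact (hEQ _).2 hn

end Edge

theorem Edge.total_add_total {μ : ℂ} {e e' : Edge} (hx : e.x ≠ 0) (hy : e.y ≠ 0)
    (hxμ : e.x ^ 2 ≠ μ) (hyμ : e.y ^ 2 ≠ μ)
    (ex : e'.x = e.x) (ey : e'.y = e.y) (ez : e'.z = e.x * e.y - e.z) (ep : e'.p = e.p)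
    (eq : e'.q = e.q) :
    e.total μ + e'.total μ = 1 - 2 * h μ e.p e.x - 2 * h μ e.q e.y := by
  have hr : e.ratio + e'.ratio = 1 := by
    unfold ratio
    rw [ex, ey, ez]
    field_simp
    ring
  rw [two_mul_h hxμ, two_mul_h hyμ]
  unfold total
  rw [ex, ey, ep, eq]
  linear_combination (1 + e.p * coeff μ e.x + e.q * coeff μ e.y) * hr

section Trace

variable {Γ : Type*} [Group Γ] (ρ : Γ →* Matrix.SpecialLinearGroup (Fin 2) ℂ)

theorem trace_mul_add (g k : Γ) :
    trace ρ (g * k) + trace ρ (g⁻¹ * k) = trace ρ g * trace ρ k := by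
  unfold trace
  rw [map_mul, map_mul, map_inv, Matrix.SpecialLinearGroup.coe_mul,
    Matrix.SpecialLinearGroup.coe_mul, Matrix.SpecialLinearGroup.coe_inv, Matrix.adjugate_fin_two]
  simp only [Matrix.trace_fin_two, Matrix.mul_apply, Fin.sum_univ_two]
  simp
  ring

theorem trace_mul_comm (g k : Γ) : trace ρ (g * k) = trace ρ (k * g) :=
  trace_of_isConj ρ (isConj_iff.2 ⟨g⁻¹, by group⟩)

theorem trace_one : trace ρ 1 = 2 := by
  unfold trace
  rw [map_one, Matrix.SpecialLinearGroup.coe_one, Matrix.trace_one]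
  simp

/-- Fricke's identity. -/
theorem fricke (s t : Γ) :
    trace ρ s ^ 2 + trace ρ t ^ 2 + trace ρ (s * t) ^ 2 - trace ρ s * trace ρ t * trace ρ (s * t) =
      trace ρ (s * t * s⁻¹ * t⁻¹) + 2 := by
  have h1 := trace_mul_add ρ s (t * s⁻¹ * t⁻¹)
  have e1 : trace ρ (t * s⁻¹ * t⁻¹) = trace ρ s := by
    rw [← trace_inv ρ s]
    exact (trace_of_isConj ρ (isConj_iff.2 ⟨t, rfl⟩)).symm
  have h2 := trace_mul_add ρ (s⁻¹ * t) (s⁻¹ * t⁻¹)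
  have e2 : trace ρ ((s⁻¹ * t)⁻¹ * (s⁻¹ * t⁻¹)) = trace ρ (t * t) := by
    rw [← trace_inv ρ (t * t)]
    congr 1
    group
  have e3 : trace ρ (s⁻¹ * t⁻¹) = trace ρ (s * t) := by
    rw [trace_mul_comm, ← mul_inv_rev, trace_inv]
  have h3 := trace_mul_add ρ s t
  have h4 := trace_mul_add ρ t t
  rw [inv_mul_cancel, trace_one] at h4
  rw [e2, e3] at h2
  have e4 : s⁻¹ * (t * s⁻¹ * t⁻¹) = s⁻¹ * t * (s⁻¹ * t⁻¹) := by group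
  rw [e1, e4] at h1
  have e5 : s * (t * s⁻¹ * t⁻¹) = s * t * s⁻¹ * t⁻¹ := by group
  rw [e5] at h1
  linear_combination -h1 + h2 - h4 + trace ρ (s * t) * h3

theorem fricke_eq_of_isBasis (b : FreeGroupBasis (Fin 2) Γ) {u v : Γ} (h : IsBasis u v) :
    trace ρ u ^ 2 + trace ρ v ^ 2 + trace ρ (u * v) ^ 2 - trace ρ u * trace ρ v * trace ρ (u * v) =
      peripheralTrace b ρ + 2 := by
  refine basis_induction b (fun u v => trace ρ u ^ 2 + trace ρ v ^ 2 + trace ρ (u * v) ^ 2 -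
    trace ρ u * trace ρ v * trace ρ (u * v) = peripheralTrace b ρ + 2) (fricke ρ _ _)
    (fun u v h => ?_) (fun u v h => ?_) (fun u v h => ?_) (fun u v g h => ?_) u v h
  · rw [trace_mul_comm ρ v u]
    linear_combination h
  · have := trace_mul_add ρ u v
    rw [trace_inv, show trace ρ (u⁻¹ * v) = trace ρ u * trace ρ v - trace ρ (u * v) by
      linear_combination this]
    linear_combination h
  · have := trace_mul_add ρ v (v * u)
    rw [inv_mul_cancel_left, trace_mul_comm ρ v u] at this
    rw [trace_mul_comm ρ (u * v) v, ← mul_assoc, mul_assoc v u v, trace_mul_comm ρ v (u * v),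
      mul_assoc, trace_mul_comm ρ u (v * v), mul_assoc,
      show trace ρ (v * (v * u)) = trace ρ v * trace ρ (u * v) - trace ρ u by
      linear_combination this]
    linear_combination h
  · have hc : ∀ x, trace ρ (g * x * g⁻¹) = trace ρ x := fun x =>
      (trace_of_isConj ρ (isConj_iff.2 ⟨g, rfl⟩)).symm
    have e1 : g * u * g⁻¹ * (g * v * g⁻¹) = g * (u * v) * g⁻¹ := by group
    rw [e1, hc, hc, hc]
    exact h

/-- The edge of the tree of traces defined by a pair of elements and a colouring. -/
noncomputable def edgeOf (b : FreeGroupBasis (Fin 2) Γ) (col : ZMod 2 × ZMod 2 → ℂ)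
    (e : Γ × Γ) : Edge :=
  ⟨trace ρ e.1, trace ρ e.2, trace ρ (e.1 * e.2),
    col (Multiplicative.toAdd (homologyModTwo b e.1)),
    col (Multiplicative.toAdd (homologyModTwo b e.2)),
    col (Multiplicative.toAdd (homologyModTwo b (e.1 * e.2)))⟩

theorem edgeOf_pairStep (b : FreeGroupBasis (Fin 2) Γ) (col : ZMod 2 × ZMod 2 → ℂ)
    (d : Bool) (e : Γ × Γ) : edgeOf ρ b col (pairStep d e) = edgeStep d (edgeOf ρ b col e) := by
  have hz : ∀ x y : ZMod 2 × ZMod 2, x + (x + y) = y := by decide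
  obtain ⟨s, t⟩ := e
  cases d
  · have h1 := trace_mul_add ρ s (s * t)
    rw [inv_mul_cancel_left] at h1
    simp only [edgeOf, pairStep, edgeStep, map_mul, toAdd_mul, hz, Edge.mk.injEq, true_and]
    exact ⟨by linear_combination h1, trivial⟩
  · have h1 := trace_mul_add ρ t (t * s)
    rw [inv_mul_cancel_left, trace_mul_comm ρ t s] at h1
    have h2 : trace ρ (t * (s * t)) = trace ρ (t * (t * s)) := by
      rw [trace_mul_comm ρ t (t * s), mul_assoc]
    simp only [edgeOf, pairStep, edgeStep, map_mul, toAdd_mul, Edge.mk.injEq, true_and]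
    refine ⟨by rw [h2]; linear_combination h1, ?_⟩
    rw [add_comm (Multiplicative.toAdd (homologyModTwo b s)), hz]

theorem edgeOf_descend (b : FreeGroupBasis (Fin 2) Γ) (col : ZMod 2 × ZMod 2 → ℂ)
    (w : List Bool) (e : Γ × Γ) :
    edgeOf ρ b col (descend pairStep w e) = descend edgeStep w (edgeOf ρ b col e) := by
  induction w generalizing e with
  | nil => rfl
  | cons d w ih => rw [descend_cons, descend_cons, ih, edgeOf_pairStep]

end Trace

theorem descend_replicate {S : Type*} (step : Bool → S → S) (n : ℕ) (e : S) :
    descend step (List.replicate n false) e = (step false)^[n] e := by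
  induction n generalizing e with
  | zero => rfl
  | succ n ih => rw [List.replicate_succ, descend_cons, ih, Function.iterate_succ_apply]

section Bowditch

variable {Γ : Type*} [Group Γ] {ρ : Γ →* Matrix.SpecialLinearGroup (Fin 2) ℂ}

theorem BowditchConditions.offSegment (hρ : BowditchConditions ρ) {g : Γ} (hg : IsPrimitive g) :
    OffSegment (trace ρ g) :=
  hρ.trace_notMem (Quotient.mk (curveSetoid Γ) ⟨g, hg⟩)

theorem BowditchConditions.finite_small_tree (hρ : BowditchConditions ρ)
    (b : FreeGroupBasis (Fin 2) Γ) (col : ZMod 2 × ZMod 2 → ℂ) (d : Bool) :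
    {w | ‖(descend edgeStep w (edgeOf ρ b col (rootPair b d))).z‖ ≤ 2}.Finite := by
  have hinj : Function.Injective (fun w => curve b (Sum.inr (d, w))) := fun w w' h => by
    simpa using curve_injective b h
  refine (hρ.finite_small.preimage hinj.injOn).subset fun w hw => ?_
  change ‖(descend edgeStep w (edgeOf ρ b col (rootPair b d))).z‖ ≤ 2 at hw
  rw [← edgeOf_descend] at hw
  exact hw

theorem BowditchConditions.trace_mul_ne (hρ : BowditchConditions ρ) {u v : Γ} (h : IsBasis u v) :
    trace ρ (u * v) ≠ trace ρ u * mcShane (trace ρ u) * trace ρ v := by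
  intro heq
  have hoff := hρ.offSegment h.isPrimitive
  obtain ⟨c, rfl, rfl⟩ := h
  have hfin := hρ.finite_small_tree c 0 false
  set e := edgeOf ρ c 0 (rootPair c false) with he
  have hinj : Function.Injective (fun n => List.replicate n false) := fun m n h => by
    simpa using congrArg List.length h
  have hfin' := hfin.preimage hinj.injOn
  set l := trace ρ (c 0) * mcShane (trace ρ (c 0)) with hl
  have hz : ∀ n, (e.spiral n).z = l * (e.spiral n).y := by
    intro n
    have := e.spiral_large hoff n
    have h0 : e.z - e.x * mcShane e.x * e.y = 0 := sub_eq_zero.2 heq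
    rw [h0, mul_zero] at this
    exact sub_eq_zero.1 this
  have hzn : ∀ n, (e.spiral n).z = l ^ (n + 1) * trace ρ (c 1) := by
    intro n
    induction n with
    | zero => rw [hz, zero_add, pow_one]; rfl
    | succ n ih => rw [hz, Edge.spiral_y_succ, ih]; ring
  have hl1 : ‖l‖ < 1 := by
    have h1 := one_lt_norm_large_root hoff
    have h2 : ‖l‖ * ‖trace ρ (c 0) * (1 - mcShane (trace ρ (c 0)))‖ = 1 := by
      rw [← norm_mul]
      have h3 := mcShane_mul (trace ρ (c 0))
      have h4 := hoff.ne_zero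
      field_simp at h3
      have : l * (trace ρ (c 0) * (1 - mcShane (trace ρ (c 0)))) = 1 := by
        rw [hl]
        linear_combination h3
      rw [this, norm_one]
    nlinarith [norm_nonneg l]
  have hlim : Tendsto (fun n => (e.spiral n).z) atTop (𝓝 0) := by
    have h1 := (tendsto_add_atTop_iff_nat 1).2 (tendsto_pow_atTop_nhds_zero_of_norm_lt_one hl1)
    have h2 := h1.mul_const (trace ρ (c 1))
    rw [zero_mul] at h2
    exact h2.congr fun n => (hzn n).symm
  have hev := (tendsto_zero_iff_norm_tendsto_zero.1 hlim).eventually_lt_const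
    (by norm_num : (0 : ℝ) < 2)
  obtain ⟨N, hN⟩ := eventually_atTop.1 hev
  refine (Set.Ici_infinite N) (hfin'.subset fun n hn => ?_)
  change ‖(descend edgeStep (List.replicate n false) e).z‖ ≤ 2
  rw [descend_replicate]
  exact (hN n hn).le

theorem BowditchConditions.trace_sq_ne (hρ : BowditchConditions ρ) (b : FreeGroupBasis (Fin 2) Γ)
    {g : Γ} (hg : IsPrimitive g) : trace ρ g ^ 2 ≠ peripheralTrace b ρ + 2 := by
  intro heq
  have hoff := hρ.offSegment hg
  obtain ⟨c, rfl⟩ := hg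
  have hb : IsBasis (c 0) (c 1) := ⟨c, rfl, rfl⟩
  have h1 := hρ.trace_mul_ne hb
  have h2 := hρ.trace_mul_ne hb.inv
  rw [trace_inv] at h2
  have h3 := trace_mul_add ρ (c 0) (c 1)
  have h4 := (edgeOf ρ c 0 (c 0, c 1)).large_mul_small hoff
  simp only [edgeOf] at h4
  rw [fricke_eq_of_isBasis ρ b hb, ← heq, sub_self] at h4
  rcases mul_eq_zero.1 h4 with h | h
  · exact h1 (sub_eq_zero.1 h)
  · apply h2
    linear_combination h3 - h

end Bowditch

section Irreducible

theorem det_sub_eq (X Y : Matrix (Fin 2) (Fin 2) ℂ) :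
    (X - Y).det = X.det + Y.det - (X * Y.adjugate).trace := by
  rw [Matrix.adjugate_fin_two]
  simp [Matrix.det_fin_two, Matrix.trace_fin_two, Matrix.mul_apply, Fin.sum_univ_two]
  ring

theorem exists_eq_smul_of_eigenvectors {A : Matrix (Fin 2) (Fin 2) ℂ} {l : ℂ}
    (hA : A.trace ≠ 2 * l) {u v : Fin 2 → ℂ} (hu : A.mulVec u = l • u) (hv : A.mulVec v = l • v)
    (hu0 : u ≠ 0) : ∃ k : ℂ, v = k • u := by
  have u0 := congrFun hu 0
  have u1 := congrFun hu 1
  have v0 := congrFun hv 0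
  have v1 := congrFun hv 1
  simp only [Matrix.mulVec, dotProduct, Fin.sum_univ_two, Pi.smul_apply, smul_eq_mul]
    at u0 u1 v0 v1
  rw [Matrix.trace_fin_two] at hA
  have hdet : u 0 * v 1 - u 1 * v 0 = 0 := by
    by_contra hne
    have h1 : A 0 0 - l = 0 := by
      apply (mul_eq_zero.1 (_ : (A 0 0 - l) * (u 0 * v 1 - u 1 * v 0) = 0)).resolve_right hne
      linear_combination v 1 * u0 - u 1 * v0
    have h2 : A 1 1 - l = 0 := by
      apply (mul_eq_zero.1 (_ : (A 1 1 - l) * (u 0 * v 1 - u 1 * v 0) = 0)).resolve_right hne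
      linear_combination u 0 * v1 - v 0 * u1
    exact hA (by linear_combination h1 + h2)
  by_cases h0 : u 0 = 0
  · have h1 : u 1 ≠ 0 := by
      intro h1
      apply hu0
      funext i
      fin_cases i
      · exact h0
      · exact h1
    refine ⟨v 1 / u 1, ?_⟩
    have hv0 : v 0 = 0 := by
      rw [h0] at hdet
      simpa [h1] using hdet
    funext i
    fin_cases i
    · simp [h0, hv0]
    · simp [h1]
  · refine ⟨v 0 / u 0, ?_⟩
    funext i
    fin_cases i
    · simp [h0]
    · simp
      field_simp
      linear_combination hdet

theorem exists_common_eigenvector {A B : Matrix (Fin 2) (Fin 2) ℂ} {l l' : ℂ} (hl : l ≠ l')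
    (htr : A.trace = l + l') (hdet : A.det = l * l') (hAB : (A * B - B * A).det = 0) :
    ∃ u : Fin 2 → ℂ, u ≠ 0 ∧ (∃ k : ℂ, A.mulVec u = k • u) ∧ ∃ k : ℂ, B.mulVec u = k • u := by
  obtain ⟨w, hw0, hw⟩ := Matrix.exists_mulVec_eq_zero_iff.2 hAB
  rw [Matrix.sub_mulVec, sub_eq_zero, ← Matrix.mulVec_mulVec, ← Matrix.mulVec_mulVec] at hw
  have cayley : ∀ (a a' : ℂ) (x : Fin 2 → ℂ), A.trace = a + a' → A.det = a * a' →
      A.mulVec (A.mulVec x - a' • x) = a • (A.mulVec x - a' • x) := by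
    intro a a' x h1 h2
    rw [Matrix.trace_fin_two] at h1
    rw [Matrix.det_fin_two] at h2
    refine funext (Fin.forall_fin_two.2 ⟨?_, ?_⟩) <;>
      simp only [Matrix.mulVec, dotProduct, Fin.sum_univ_two, Pi.sub_apply, Pi.smul_apply,
        smul_eq_mul]
    · linear_combination (A 0 0 * x 0 + A 0 1 * x 1) * h1 - x 0 * h2
    · linear_combination (A 1 0 * x 0 + A 1 1 * x 1) * h1 - x 1 * h2
  have main : ∀ a a' : ℂ, a ≠ a' → A.trace = a + a' → A.det = a * a' →
      A.mulVec w - a' • w ≠ 0 → ∃ u : Fin 2 → ℂ, u ≠ 0 ∧ (∃ k : ℂ, A.mulVec u = k • u) ∧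
        ∃ k : ℂ, B.mulVec u = k • u := by
    intro a a' haa h1 h2 h3
    refine ⟨_, h3, ⟨a, cayley a a' w h1 h2⟩, ?_⟩
    apply exists_eq_smul_of_eigenvectors (A := A) (l := a) _ (cayley a a' w h1 h2) _ h3
    · rw [h1]
      intro h
      exact haa (by linear_combination -h)
    · rw [Matrix.mulVec_sub, Matrix.mulVec_smul, ← hw]
      exact cayley a a' _ h1 h2
  by_cases h3 : A.mulVec w - l' • w = 0
  · refine main l' l hl.symm (by rw [htr, add_comm]) (by rw [hdet, mul_comm]) fun h4 => ?_
    have h5 : (l - l') • w = 0 := by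
      rw [sub_smul, ← sub_eq_zero.1 h3, ← sub_eq_zero.1 h4, sub_self]
    rcases smul_eq_zero.1 h5 with h | h
    · exact hl (sub_eq_zero.1 h)
    · exact hw0 h
  · exact main l l' hl htr hdet h3

theorem IsIrreducible.peripheralTrace_ne {Γ : Type*} [Group Γ] (b : FreeGroupBasis (Fin 2) Γ)
    {ρ : Γ →* Matrix.SpecialLinearGroup (Fin 2) ℂ} (hirr : IsIrreducible ρ)
    (hρ : BowditchConditions ρ) : peripheralTrace b ρ ≠ 2 := by
  intro h2
  have hoff := hρ.offSegment (g := b 0) ⟨b, rfl⟩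
  obtain ⟨A, hA⟩ : ∃ A : Matrix (Fin 2) (Fin 2) ℂ, A = ρ (b 0) := ⟨_, rfl⟩
  obtain ⟨B, hB⟩ : ∃ B : Matrix (Fin 2) (Fin 2) ℂ, B = ρ (b 1) := ⟨_, rfl⟩
  have hAB : (A * B - B * A).det = 0 := by
    rw [det_sub_eq, Matrix.det_mul, Matrix.det_mul, hA, hB, Matrix.SpecialLinearGroup.det_coe,
      Matrix.SpecialLinearGroup.det_coe, Matrix.adjugate_mul_distrib]
    have : peripheralTrace b ρ = ((ρ (b 0) : Matrix (Fin 2) (Fin 2) ℂ) * ρ (b 1) *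
        ((ρ (b 0) : Matrix (Fin 2) (Fin 2) ℂ).adjugate *
          (ρ (b 1) : Matrix (Fin 2) (Fin 2) ℂ).adjugate)).trace := by
      simp [peripheralTrace, trace, mul_assoc]
    rw [← this, h2]
    norm_num
  have hx0 := hoff.ne_zero
  have hm := mcShane_mul (trace ρ (b 0))
  set x := trace ρ (b 0) with hx
  field_simp at hm
  obtain ⟨u, hu0, ⟨k, hk⟩, k', hk'⟩ := exists_common_eigenvector (A := A) (B := B)
    (l := x * mcShane x) (l' := x * (1 - mcShane x)) (by
      intro h
      have h1 := mcShaneSqrt_re_pos hoff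
      have h3 : mcShaneSqrt x = 0 := by
        have := mul_left_cancel₀ hx0 h
        unfold mcShane at this
        linear_combination -this
      rw [h3] at h1
      simp at h1)
    (by rw [hA]; change x = _; ring)
    (by rw [hA, Matrix.SpecialLinearGroup.det_coe]; linear_combination -hm) hAB
  have key : ∀ (g : Γ) (c : ℂ), (ρ g : Matrix (Fin 2) (Fin 2) ℂ).mulVec u = c • u →
      ∃ c' : ℂ, (ρ g⁻¹ : Matrix (Fin 2) (Fin 2) ℂ).mulVec u = c' • u := by
    intro g c hc
    have h1 : (ρ g⁻¹ : Matrix (Fin 2) (Fin 2) ℂ).mulVec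
        ((ρ g : Matrix (Fin 2) (Fin 2) ℂ).mulVec u) = u := by
      rw [Matrix.mulVec_mulVec, ← Matrix.SpecialLinearGroup.coe_mul, ← map_mul, inv_mul_cancel,
        map_one, Matrix.SpecialLinearGroup.coe_one, Matrix.one_mulVec]
    rw [hc, Matrix.mulVec_smul] at h1
    have hc0 : c ≠ 0 := by
      rintro rfl
      rw [zero_smul] at h1
      exact hu0 h1.symm
    refine ⟨c⁻¹, ?_⟩
    nth_rewrite 2 [← h1]
    rw [smul_smul, inv_mul_cancel₀ hc0, one_smul]
  have hgen : ∀ i : Fin 2, ∃ c : ℂ, (ρ (b i) : Matrix (Fin 2) (Fin 2) ℂ).mulVec u = c • u := by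
    intro i
    fin_cases i
    · exact ⟨k, hA ▸ hk⟩
    · exact ⟨k', hB ▸ hk'⟩
  have hall : ∀ y : FreeGroup (Fin 2), ∃ c : ℂ,
      (ρ (b.repr.symm y) : Matrix (Fin 2) (Fin 2) ℂ).mulVec u = c • u := by
    intro y
    induction y using FreeGroup.induction_on with
    | C1 => exact ⟨1, by simp⟩
    | of i => exact hgen i
    | inv_of i hi =>
      obtain ⟨c, hc⟩ := hi
      rw [map_inv]
      exact key _ c hc
    | mul y z hy hz =>
      obtain ⟨c, hc⟩ := hy
      obtain ⟨c', hc'⟩ := hz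
      refine ⟨c' * c, ?_⟩
      rw [map_mul, map_mul, Matrix.SpecialLinearGroup.coe_mul, ← Matrix.mulVec_mulVec, hc',
        Matrix.mulVec_smul, hc, smul_smul]
  have hinv := hirr (Submodule.span ℂ {u}) fun g v hv => by
    obtain ⟨c, hc⟩ := hall (b.repr g)
    rw [MulEquiv.symm_apply_apply] at hc
    obtain ⟨a, rfl⟩ := Submodule.mem_span_singleton.1 hv
    rw [Matrix.mulVec_smul, hc]
    exact Submodule.smul_mem _ _ (Submodule.smul_mem _ _ (Submodule.mem_span_singleton_self u))
  rcases hinv with h | h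
  · exact hu0 (Submodule.span_singleton_eq_bot.1 h)
  · have h1 := finrank_span_singleton (K := ℂ) hu0
    rw [h, finrank_top] at h1
    simp at h1

end Irreducible

section Colouring

variable {Γ : Type*} [Group Γ] (b : FreeGroupBasis (Fin 2) Γ)

theorem homologyModTwo_ne_zero (X : Omega Γ) : X.homologyModTwo b ≠ 0 := by
  induction X using Quotient.inductionOn with
  | _ g =>
    obtain ⟨g, c, rfl⟩ := g
    let φ : Γ → ZMod 2 × ZMod 2 := fun g => Multiplicative.toAdd (homologyModTwo b g)
    have hφm : ∀ g k, φ (g * k) = φ g + φ k := fun g k => by simp [φ]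
    have hφi : ∀ g, φ g⁻¹ = φ g := fun g => by
      have : ∀ z : ZMod 2 × ZMod 2, -z = z := by decide
      simp only [φ, map_inv, toAdd_inv, this]
    have h0 : φ (b 0) = (1, 0) := by simp [φ, homologyModTwo]
    have h1 : φ (b 1) = (0, 1) := by simp [φ, homologyModTwo]
    have hz : ∀ x y : ZMod 2 × ZMod 2, x ≠ 0 → y ≠ 0 → x ≠ y →
        x + y ≠ 0 ∧ x + y ≠ y := by
      intro x y hx _ hxy
      have hneg : ∀ z : ZMod 2 × ZMod 2, -z = z := by decide
      exact ⟨fun h => hxy ((eq_neg_of_add_eq_zero_left h).trans (hneg y)),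
        fun h => hx (add_eq_right.1 h)⟩
    have := basis_induction b (fun u v => φ u ≠ 0 ∧ φ v ≠ 0 ∧ φ u ≠ φ v)
      (by rw [h0, h1]; decide) (fun u v h => ⟨h.2.1, h.1, h.2.2.symm⟩)
      (fun u v h => by rw [hφi]; exact h)
      (fun u v h => by
        rw [hφm]
        exact ⟨(hz _ _ h.1 h.2.1 h.2.2).1, h.2.1, (hz _ _ h.1 h.2.1 h.2.2).2⟩)
      (fun u v g h => by
        have hc : ∀ x, φ (g * x * g⁻¹) = φ x := fun x => by
          have : ∀ y z : ZMod 2 × ZMod 2, y + z + y = z := by decide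
          rw [hφm, hφm, hφi, this]
        rw [hc, hc]
        exact h) (c 0) (c 1) ⟨c, rfl, rfl⟩
    exact this.1

/-- The colouring of the nonzero classes modulo two with given colours. -/
noncomputable def colouring (p₁ p₂ p₃ : ℂ) (v : ZMod 2 × ZMod 2) : ℂ :=
  if v = (1, 0) then p₁ else if v = (0, 1) then p₂ else p₃

end Colouring

theorem hasSum_curves {Γ : Type*} [Group Γ] (b : FreeGroupBasis (Fin 2) Γ)
    {ρ : Γ →* Matrix.SpecialLinearGroup (Fin 2) ℂ} (hρ : BowditchConditions ρ)
    {μ : ℂ} (hμ : μ = peripheralTrace b ρ + 2) (hμ4 : μ ≠ 4)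
    {p₁ p₂ p₃ : ℂ} (hp : p₁ + p₂ + p₃ = 1) :
    HasSum (fun X : Omega Γ => h μ (colouring p₁ p₂ p₃ (X.homologyModTwo b)) (X.trace ρ))
      (1 / 2) := by
  set col := colouring p₁ p₂ p₃ with hcol
  have hne : ∀ {g : Γ}, IsPrimitive g → trace ρ g ^ 2 ≠ μ := fun hg => hμ ▸ hρ.trace_sq_ne b hg
  set f : Omega Γ → ℂ := fun X => h μ (col (X.homologyModTwo b)) (X.trace ρ) with hf
  have c10 : col (1, 0) = p₁ := by simp [hcol, colouring]
  have c01 : col (0, 1) = p₂ := by simp [hcol, colouring]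
  have c11 : col (1, 1) = p₃ := by simp [hcol, colouring]
  set P := max (max ‖p₁‖ ‖p₂‖) ‖p₃‖ with hP
  have hP1 : ‖p₁‖ ≤ P := (le_max_left _ _).trans (le_max_left _ _)
  have hP2 : ‖p₂‖ ≤ P := (le_max_right _ _).trans (le_max_left _ _)
  have hP3 : ‖p₃‖ ≤ P := le_max_right _ _
  have hcolors : ∀ d, (edgeOf ρ b col (rootPair b d)).p = p₁ ∧
      (edgeOf ρ b col (rootPair b d)).q = p₂ ∧ (edgeOf ρ b col (rootPair b d)).r = p₃ := by
    have hneg : (-1 : ZMod 2) = 1 := by decide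
    intro d
    cases d <;> simp [edgeOf, rootPair, homologyModTwo, hneg, c10, c01, c11]
  have hadm : ∀ d, (edgeOf ρ b col (rootPair b d)).Admissible μ P := by
    intro d
    obtain ⟨e1, e2, e3⟩ := hcolors d
    have hb := isBasis_rootPair b d
    have hz : ∀ w, IsPrimitive ((descend pairStep w (rootPair b d)).1 *
        (descend pairStep w (rootPair b d)).2) := fun w => (hb.descend w).mul.isPrimitive
    refine ⟨hρ.offSegment hb.isPrimitive, hρ.offSegment hb.swap.isPrimitive, hne hb.isPrimitive,
      hne hb.swap.isPrimitive, ?_, by rw [e1, e2, e3, hp], by rw [e1]; exact hP1,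
      by rw [e2]; exact hP2, by rw [e3]; exact hP3, fun w => ?_, fun w => ?_,
      hρ.finite_small_tree b col d⟩
    · rw [hμ]
      exact fricke_eq_of_isBasis ρ b hb
    · rw [← edgeOf_descend]
      exact hρ.offSegment (hz w)
    · rw [← edgeOf_descend]
      exact hne (hz w)
  have hsum : ∀ d, HasSum (fun w => 2 * f (curve b (Sum.inr (d, w))))
      ((edgeOf ρ b col (rootPair b d)).total μ) := by
    intro d
    have h1 := (hadm d).hasSum hμ4 ((norm_nonneg _).trans hP1)
    have h2 : (fun w => (descend edgeStep w (edgeOf ρ b col (rootPair b d))).term μ) =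
        fun w => 2 * f (curve b (Sum.inr (d, w))) := by
      funext w
      rw [← edgeOf_descend]
      rfl
    rwa [h2] at h1
  have htot : (edgeOf ρ b col (rootPair b false)).total μ +
      (edgeOf ρ b col (rootPair b true)).total μ =
      1 - 2 * f (curve b (Sum.inl 0)) - 2 * f (curve b (Sum.inl 1)) := by
    have hadf := hadm false
    obtain ⟨e1, e2, -⟩ := hcolors false
    obtain ⟨e3, e4, -⟩ := hcolors true
    refine Edge.total_add_total hadf.off_x.ne_zero hadf.off_y.ne_zero hadf.ne_x hadf.ne_y rfl
      (trace_inv ρ _) ?_ (e3.trans e1.symm) (e4.trans e2.symm)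
    have h1 := trace_mul_add ρ (b 1) (b 0)
    simp only [edgeOf, rootPair]
    rw [trace_mul_comm ρ (b 0), trace_mul_comm ρ (b 0)]
    linear_combination h1
  have h2 : HasSum (fun X => 2 * f X) 1 := by
    rw [← (curveEquiv b).hasSum_iff]
    have h3 : HasSum (fun i : Fin 2 => 2 * f (curve b (Sum.inl i)))
        (2 * f (curve b (Sum.inl 0)) + 2 * f (curve b (Sum.inl 1))) := by
      have := hasSum_fintype (fun i : Fin 2 => 2 * f (curve b (Sum.inl i)))
      rwa [Fin.sum_univ_two] at this
    have h4 : HasSum (fun i : Bool × List Bool => 2 * f (curve b (Sum.inr i)))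
        ((edgeOf ρ b col (rootPair b false)).total μ +
          (edgeOf ρ b col (rootPair b true)).total μ) := by
      rw [← (Equiv.boolProdEquivSum (List Bool)).symm.hasSum_iff]
      exact HasSum.sum (hsum false) (hsum true)
    have h5 := HasSum.sum (f := (fun X => 2 * f X) ∘ curveEquiv b) h3 h4
    rw [htot] at h5
    convert h5 using 1
    ring
  have h6 := h2.mul_left (1 / 2)
  simpa using h6

end PuncturedTorus

theorem theorem1p3 {Γ : Type*} [Group Γ] (b : FreeGroupBasis (Fin 2) Γ)
    (ρ : Γ →* Matrix.SpecialLinearGroup (Fin 2) ℂ)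
    (hirr : PuncturedTorus.IsIrreducible ρ)
    (hρ : PuncturedTorus.BowditchConditions ρ)
    (μ : ℂ) (hμ : μ = PuncturedTorus.peripheralTrace b ρ + 2)
    (p₁ p₂ p₃ : ℂ) (hp : p₁ + p₂ + p₃ = 1) :
    -- the traces lie in the domain of the functions `h_{μ,p}`
    (∀ X : PuncturedTorus.Omega Γ, (X.trace ρ) ^ 2 ≠ μ) ∧
    -- the three sums converge absolutely
    Summable (fun X : PuncturedTorus.Omega₁ b => ‖PuncturedTorus.h μ p₁ (X.1.trace ρ)‖) ∧
    Summable (fun X : PuncturedTorus.Omega₂ b => ‖PuncturedTorus.h μ p₂ (X.1.trace ρ)‖) ∧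
    Summable (fun X : PuncturedTorus.Omega₃ b => ‖PuncturedTorus.h μ p₃ (X.1.trace ρ)‖) ∧
    (∑' X : PuncturedTorus.Omega₁ b, PuncturedTorus.h μ p₁ (X.1.trace ρ)) +
      (∑' X : PuncturedTorus.Omega₂ b, PuncturedTorus.h μ p₂ (X.1.trace ρ)) +
      (∑' X : PuncturedTorus.Omega₃ b, PuncturedTorus.h μ p₃ (X.1.trace ρ)) = 1 / 2 := by
  have hμ4 : μ ≠ 4 := by
    intro h4
    apply hirr.peripheralTrace_ne b hρ
    linear_combination h4 - hμ
  have hsum := PuncturedTorus.hasSum_curves b hρ hμ hμ4 hp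
  set f : PuncturedTorus.Omega Γ → ℂ := fun X =>
    PuncturedTorus.h μ (PuncturedTorus.colouring p₁ p₂ p₃ (X.homologyModTwo b)) (X.trace ρ) with hf
  have e1 : (fun X : PuncturedTorus.Omega₁ b => PuncturedTorus.h μ p₁ (X.1.trace ρ)) =
      fun X => f X.1 := by
    funext ⟨X, hX⟩
    have hX' : X.homologyModTwo b = (1, 0) := hX
    simp [hf, hX', PuncturedTorus.colouring]
  have e2 : (fun X : PuncturedTorus.Omega₂ b => PuncturedTorus.h μ p₂ (X.1.trace ρ)) =
      fun X => f X.1 := by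
    funext ⟨X, hX⟩
    have hX' : X.homologyModTwo b = (0, 1) := hX
    simp [hf, hX', PuncturedTorus.colouring]
  have e3 : (fun X : PuncturedTorus.Omega₃ b => PuncturedTorus.h μ p₃ (X.1.trace ρ)) =
      fun X => f X.1 := by
    funext ⟨X, hX⟩
    have hX' : X.homologyModTwo b = (1, 1) := hX
    simp [hf, hX', PuncturedTorus.colouring]
  have hn : Summable fun X => ‖f X‖ := hsum.summable.norm
  refine ⟨fun X => ?_, ?_, ?_, ?_, ?_⟩
  · induction X using Quotient.inductionOn with
    | _ g =>
      rw [hμ]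
      exact hρ.trace_sq_ne b g.2
  · exact (hn.subtype (PuncturedTorus.Omega₁ b)).congr fun X => by rw [congrFun e1 X]; rfl
  · exact (hn.subtype (PuncturedTorus.Omega₂ b)).congr fun X => by rw [congrFun e2 X]; rfl
  · exact (hn.subtype (PuncturedTorus.Omega₃ b)).congr fun X => by rw [congrFun e3 X]; rfl
  · rw [e1, e2, e3, tsum_subtype (PuncturedTorus.Omega₁ b) f,
      tsum_subtype (PuncturedTorus.Omega₂ b) f, tsum_subtype (PuncturedTorus.Omega₃ b) f,
      ← (hsum.summable.indicator _).tsum_add (hsum.summable.indicator _),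
      ← ((hsum.summable.indicator _).add (hsum.summable.indicator _)).tsum_add
        (hsum.summable.indicator _), ← hsum.tsum_eq]
    congr 1
    funext X
    have hX := PuncturedTorus.homologyModTwo_ne_zero b X
    have hv : ∀ v : ZMod 2 × ZMod 2, v = 0 ∨ v = (1, 0) ∨ v = (0, 1) ∨ v = (1, 1) := by decide
    have hmem : ∀ (s : Set (PuncturedTorus.Omega Γ)) (v v' : ZMod 2 × ZMod 2),
        s = {X | X.homologyModTwo b = v'} → X.homologyModTwo b = v →
        s.indicator f X = if v = v' then f X else 0 := by
      rintro s v v' rfl rfl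
      rw [Set.indicator_apply]
      rfl
    rcases (hv (X.homologyModTwo b)).resolve_left hX with h | h | h <;>
      rw [hmem (PuncturedTorus.Omega₁ b) _ _ rfl h, hmem (PuncturedTorus.Omega₂ b) _ _ rfl h,
        hmem (PuncturedTorus.Omega₃ b) _ _ rfl h] <;> simp
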